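/- Let $n,m\ge 0$ be integers (the case of interest being $n,m\ge1$) and let $u=(u_{(i,j),(k,l)})$ be a unitary $nm\times nm$ matrix with rows and columns indexed by $\{1,\dots,n\}\times\{1,\dots,m\}$. Let $E=\mathbb C^n$ and $F=\mathbb C^m$ have the standard bases $(e_i)$ and $(f_j)$, identify $F\otimes E$ with $E\otimes F$ through $$e_i\otimes f_j=\sum_{k,l}u_{(i,j),(k,l)}\,f_l\otimes e_k ,$$ and let $L_{e_i}$, $L_{f_j}$ be the operators of tensoring on the left by $e_i$, $f_j$ on the Fock space $\bigoplus_{k,l\ge0}E^{\otimes k}\otimes F^{\otimes l}$ (Hilbert space direct sum), where this identification is used to write $f_j\otimes\xi$ in $E^{\otimes k}\otimes F^{\otimes(l+1)}$. Let $\mathcal A_u$ be the norm closed unital algebra generated by these operators. An isometric automorphism of $\mathcal A_u$ is an isometric bijective $\mathbb C$-algebra homomorphism $\mathcal A_u\to\mathcal A_u$. Write $L_\zeta=\sum_i\zeta_iL_{e_i}$ for $\zeta\in\mathbb C^n$, and similarly for $\zeta\in\mathbb C^m$ and the $L_{f_j}$. Let $\mathbb B_d$ be the open unit ball of $\mathbb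 C^d$. The core $\Omega_u^0$ is the set of $(z,w)\in\overline{\mathbb B}_n\times\overline{\mathbb B}_m$ such that $C_{(i,j)}w=0$ and $C_{(i,j)}^{t}z=0$ for all $i,j$, where $C_{(i,j)}$ is the $n\times m$ matrix with $(k,l)$ entry $u_{(i,j),(k,l)}-\delta_{ik}\delta_{jl}$. (1) For every $(z,w)\in\Omega_u^0\cap(\mathbb B_n\times\mathbb B_m)$ there is exactly one isometric automorphism $\Theta_{z,w}$ of $\mathcal A_u$ with $$\Theta_{z,w}(L_{e_i})=(x_0I-L_\eta)^{-1}\bigl(L_{X_1e_i}-\overline{\eta_i}\,I\bigr)\qquad(1\le i\le n),$$ where $x_0=(1-\|z\|^2)^{-1/2}$, $\eta=x_0\bar z$, $X_1=(I+\eta\eta^*)^{1/2}$, and with $\Theta_{z,w}(L_{f_j})$, $1\le j\le m$, given by the same formula with $w$ and the $L_{f_j}$ in place of $z$ and the $L_{e_i}$. (2) For all unitary matrices $A\in M_n(\mathbb C)$, $B\in M_m(\mathbb C)$ with $(A\otimes B)u=u(A\otimes B)$, where $(A\otimes B)_{(i,j),(k,l)}=a_{i,k}b_{j,l}$, there is exactly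 one isometric automorphism $\Psi_{A,B}$ of $\mathcal A_u$ with $\Psi_{A,B}(L_{e_i})=\sum_ja_{i,j}L_{e_j}$ and $\Psi_{A,B}(L_{f_k})=\sum_lb_{k,l}L_{f_l}$. (3) If $n\ne m$, then the isometric automorphisms of $\mathcal A_u$ are exactly the maps $\Psi_{A,B}\Theta_{z,w}$, where $(z,w)\in\Omega_u^0\cap(\mathbb B_n\times\mathbb B_m)$ and $A,B$ are unitary with $(A\otimes B)u=u(A\otimes B)$. (4) If $n=m$, let $\tilde u_{(i,j),(k,l)}=\overline{u_{(l,k),(j,i)}}$. For all unitary $A,B\in M_n(\mathbb C)$ with $(A\otimes B)\tilde u=u(A\otimes B)$ there is exactly one isometric automorphism $\tilde\Psi_{A,B}$ of $\mathcal A_u$ with $\tilde\Psi_{A,B}(L_{e_i})=\sum_ja_{i,j}L_{f_j}$ and $\tilde\Psi_{A,B}(L_{f_k})=\sum_lb_{k,l}L_{e_l}$. The isometric automorphisms of $\mathcal A_u$ are exactly the maps $\Psi_{A,B}\Theta_{z,w}$ as in (3) together with the maps $\tilde\Psi_{A,B}\Theta_{z,w}$, where $(z,w)\in\Omega_u^0\cap(\mathbb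 B_n\times\mathbb B_m)$ and $A,B$ are unitary with $(A\otimes B)\tilde u=u(A\otimes B)$. -/

import Mathlib

open scoped Kronecker

noncomputable section

namespace UnitaryRelation

/-- The Fock space `⨁_{k,l} (ℂⁿ)^{⊗k} ⊗ (ℂᵐ)^{⊗l}` (Hilbert space direct sum), presented through its
orthonormal basis `e_{i₁} ⊗ ⋯ ⊗ e_{i_k} ⊗ f_{j₁} ⊗ ⋯ ⊗ f_{j_l}`, which is indexed by the pairs of
words `([i₁, …, i_k], [j₁, …, j_l])`. -/
abbrev Fock (n m : ℕ) : Type :=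
  lp (fun _ : List (Fin n) × List (Fin m) => ℂ) 2

variable {n m : ℕ}

/-- The basis vector `e_{i₁} ⊗ ⋯ ⊗ e_{i_k} ⊗ f_{j₁} ⊗ ⋯ ⊗ f_{j_l}`. -/
def ket (p : List (Fin n) × List (Fin m)) : Fock n m := lp.single 2 p (1 : ℂ)

theorem inner_ket (p q : List (Fin n) × List (Fin m)) :
    inner ℂ (ket p) (ket q) = if p = q then (1 : ℂ) else 0 := by
  unfold ket
  rw [lp.inner_single_left, lp.single_apply]
  by_cases h : p = q
  · subst h; simp
  · simp [h]

theorem orthonormal_ket : Orthonormal ℂ (ket : List (Fin n) × List (Fin m) → Fock n m) := by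
  rw [orthonormal_iff_ite]
  exact inner_ket

/-- The isometry of the Fock space that maps the basis vectors to a given orthonormal family. -/
def isometryOf (v : List (Fin n) × List (Fin m) → Fock n m) (hv : Orthonormal ℂ v) :
    Fock n m →ₗᵢ[ℂ] Fock n m :=
  hv.orthogonalFamily.linearIsometry

/-- `isometryOf v` maps the basis vector with index `p` to `v p`. -/
theorem isometryOf_ket (v : List (Fin n) × List (Fin m) → Fock n m) (hv : Orthonormal ℂ v)
    (p : List (Fin n) × List (Fin m)) : isometryOf v hv (ket p) = v p := by
  unfold isometryOf ket
  rw [OrthogonalFamily.linearIsometry_apply_single]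
  simp

theorem orthonormal_eVec (i : Fin n) :
    Orthonormal ℂ (fun p : List (Fin n) × List (Fin m) => ket (i :: p.1, p.2)) :=
  orthonormal_ket.comp (fun p : List (Fin n) × List (Fin m) => (i :: p.1, p.2)) (by
    rintro ⟨a, b⟩ ⟨c, d⟩ h
    simpa using h)

/-- The shift `L_{e_i}` as an isometry: `e_a ⊗ f_b ↦ e_i ⊗ e_a ⊗ f_b`. -/
def eIso (i : Fin n) : Fock n m →ₗᵢ[ℂ] Fock n m :=
  isometryOf _ (orthonormal_eVec i)

/-- The vector `f_l ⊗ e_a ⊗ f_b`, for words `a` and `b`, written in the basis of the Fock space by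
moving `f_l` to the right through `f_l ⊗ e_k = ∑_{i,j} conj(u_{(i,j),(k,l)}) e_i ⊗ f_j`. -/
def fVec (u : Matrix.unitaryGroup (Fin n × Fin m) ℂ) :
    List (Fin n) → List (Fin m) → Fin m → Fock n m
  | [], b, l => ket ([], l :: b)
  | k :: a, b, l => ∑ i, ∑ j, star (u.1 (i, j) (k, l)) • eIso i (fVec u a b j)

theorem inner_eIso_ket_nil (i : Fin n) (x : Fock n m) (b : List (Fin m)) :
    inner ℂ (eIso i x) (ket ([], b)) = (0 : ℂ) := by
  have h : inner ℂ (ket ([], b)) (eIso i x) = (0 : ℂ) := by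
    have hx := (orthonormal_eVec (m := m) i).orthogonalFamily.hasSum_linearIsometry x
    have h2 := hx.mapL (innerSL ℂ (ket (([], b) : List (Fin n) × List (Fin m))))
    refine h2.unique ?_
    convert hasSum_zero using 2 with p
    simp [inner_ket]
  rw [← inner_conj_symm, h, map_zero]

theorem inner_eIso_eIso (i j : Fin n) (x y : Fock n m) :
    inner ℂ (eIso i x) (eIso j y) = if i = j then (inner ℂ x y : ℂ) else 0 := by
  by_cases hij : i = j
  · subst hij; simp
  · rw [if_neg hij]
    have hx := (orthonormal_eVec (m := m) i).orthogonalFamily.hasSum_linearIsometry x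
    have hy := (orthonormal_eVec (m := m) j).orthogonalFamily.hasSum_linearIsometry y
    have key : ∀ p : List (Fin n) × List (Fin m),
        inner ℂ (ket (i :: p.1, p.2)) (eIso j y) = (0 : ℂ) := by
      intro p
      have h2 := hy.mapL (innerSL ℂ (ket (i :: p.1, p.2)))
      refine h2.unique ?_
      convert hasSum_zero using 2 with q
      simp [inner_ket, hij]
    have h3 : inner ℂ (eIso j y) (eIso i x) = (0 : ℂ) := by
      have h2 := hx.mapL (innerSL ℂ (eIso j y))
      refine h2.unique ?_
      convert hasSum_zero using 2 with q
      have := key q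
      rw [← inner_conj_symm, map_eq_zero] at this
      simp [this]
    rw [← inner_conj_symm, h3, map_zero]

theorem inner_fVec (u : Matrix.unitaryGroup (Fin n × Fin m) ℂ) (b b' : List (Fin m)) :
    ∀ (a a' : List (Fin n)) (l l' : Fin m),
      inner ℂ (fVec u a b l) (fVec u a' b' l') =
        if (a = a' ∧ b = b') ∧ l = l' then (1 : ℂ) else 0 := by
  intro a
  induction a with
  | nil =>
    intro a' l l'
    cases a' with
    | nil => simp [fVec, inner_ket, and_comm]
    | cons k' a' =>
      rw [← inner_conj_symm]
      simp [fVec, sum_inner, inner_smul_left, inner_eIso_ket_nil]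
  | cons k a ih =>
    intro a' l l'
    cases a' with
    | nil => simp [fVec, inner_eIso_ket_nil]
    | cons k' a' =>
      have hu := congrFun (congrFun (Matrix.mem_unitaryGroup_iff'.1 u.2) (k', l')) (k, l)
      rw [Matrix.mul_apply, Fintype.sum_prod_type, Matrix.one_apply] at hu
      simp only [Matrix.star_apply] at hu
      simp only [fVec, sum_inner, inner_sum, inner_smul_left, inner_smul_right, inner_eIso_eIso,
        ih]
      by_cases hab : a = a' ∧ b = b'
      · obtain ⟨rfl, rfl⟩ := hab
        simp only [mul_ite, mul_one, mul_zero]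
        simp
        simp only [Prod.mk.injEq, eq_comm (a := k'), eq_comm (a := l')] at hu
        exact hu
      · have h2 : ¬ (((k :: a = k' :: a') ∧ b = b') ∧ l = l') := by
          rintro ⟨⟨h, h'⟩, -⟩
          exact hab ⟨(List.cons.inj h).2, h'⟩
        simp [hab]
        grind

theorem orthonormal_fVec (u : Matrix.unitaryGroup (Fin n × Fin m) ℂ) (l : Fin m) :
    Orthonormal ℂ (fun p : List (Fin n) × List (Fin m) => fVec u p.1 p.2 l) := by
  rw [orthonormal_iff_ite]
  rintro ⟨a, b⟩ ⟨a', b'⟩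
  simp [inner_fVec]

/-- The shift operator `L_{e_i}` on the Fock space. -/
def Le (i : Fin n) : Fock n m →L[ℂ] Fock n m := (eIso i).toContinuousLinearMap

/-- The shift operator `L_{f_l}` on the Fock space: `e_a ⊗ f_b ↦ f_l ⊗ e_a ⊗ f_b`. -/
def Lf (u : Matrix.unitaryGroup (Fin n × Fin m) ℂ) (l : Fin m) : Fock n m →L[ℂ] Fock n m :=
  (isometryOf _ (orthonormal_fVec u l)).toContinuousLinearMap

/-- The algebra `𝒜_u`: the norm closed unital algebra generated by the shifts. -/
def algA (u : Matrix.unitaryGroup (Fin n × Fin m) ℂ) :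
    Subalgebra ℂ (Fock n m →L[ℂ] Fock n m) :=
  (Algebra.adjoin ℂ (Set.range Le ∪ Set.range (Lf u))).topologicalClosure

/-- `L_{e_i}` as an element of `𝒜_u`. -/
def genE (u : Matrix.unitaryGroup (Fin n × Fin m) ℂ) (i : Fin n) : algA u :=
  ⟨Le i, Subalgebra.le_topologicalClosure _ (Algebra.subset_adjoin (Or.inl ⟨i, rfl⟩))⟩

/-- `L_{f_j}` as an element of `𝒜_u`. -/
def genF (u : Matrix.unitaryGroup (Fin n × Fin m) ℂ) (j : Fin m) : algA u :=
  ⟨Lf u j, Subalgebra.le_topologicalClosure _ (Algebra.subset_adjoin (Or.inr ⟨j, rfl⟩))⟩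

/-- The `n × m` matrix `C_{(i,j)} = u_{(i,j)} - E_{i,j}`, where `u_{(i,j)}` has the `(k,l)` entry
`u_{(i,j),(k,l)}`. -/
def coreMatrix (u : Matrix.unitaryGroup (Fin n × Fin m) ℂ) (i : Fin n) (j : Fin m) :
    Matrix (Fin n) (Fin m) ℂ :=
  Matrix.of (fun k l => u.1 (i, j) (k, l)) - Matrix.single i j 1

/-- The core `Ω_u⁰`, a subset of the product of the closed Euclidean unit balls. -/
def core (u : Matrix.unitaryGroup (Fin n × Fin m) ℂ) :
    Set (EuclideanSpace ℂ (Fin n) × EuclideanSpace ℂ (Fin m)) :=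
  {p | ‖p.1‖ ≤ 1 ∧ ‖p.2‖ ≤ 1 ∧
    ∀ i j, (coreMatrix u i j).mulVec p.2 = 0 ∧ (coreMatrix u i j).transpose.mulVec p.1 = 0}

/-- The part of the core inside the product of the open unit balls. -/
def openCore (u : Matrix.unitaryGroup (Fin n × Fin m) ℂ) :
    Set (EuclideanSpace ℂ (Fin n) × EuclideanSpace ℂ (Fin m)) :=
  {p | p ∈ core u ∧ ‖p.1‖ < 1 ∧ ‖p.2‖ < 1}

/-- `x₀ = (1 - ‖z‖²)^{-1/2}`. -/
def xZero {d : ℕ} (z : EuclideanSpace ℂ (Fin d)) : ℝ := (Real.sqrt (1 - ‖z‖ ^ 2))⁻¹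

/-- `η = x₀ z̄`. -/
def eta {d : ℕ} (z : EuclideanSpace ℂ (Fin d)) (i : Fin d) : ℂ := xZero z * star (z i)

/-- `X₁ = (I + η η*)^{1/2}`, which equals `I + (x₀ + 1)⁻¹ η η*` since `‖η‖² = x₀² - 1`. -/
def xOne {d : ℕ} (z : EuclideanSpace ℂ (Fin d)) : Matrix (Fin d) (Fin d) ℂ :=
  1 + ((xZero z + 1 : ℝ) : ℂ)⁻¹ • Matrix.vecMulVec (eta z) (star (eta z))

open scoped ComplexOrder in
theorem xOne_posSemidef {d : ℕ} (z : EuclideanSpace ℂ (Fin d)) : (xOne z).PosSemidef := by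
  unfold xOne
  refine Matrix.PosSemidef.one.add ?_
  have h : (0 : ℝ) ≤ (xZero z + 1)⁻¹ := by
    unfold xZero; positivity
  rw [← Complex.ofReal_inv]
  exact (Matrix.posSemidef_vecMulVec_self_star (eta z)).smul (by exact_mod_cast h)

theorem xOne_sq {d : ℕ} (z : EuclideanSpace ℂ (Fin d)) (hz : ‖z‖ < 1) :
    xOne z * xOne z = 1 + Matrix.vecMulVec (eta z) (star (eta z)) := by
  have h1 : 0 < 1 - ‖z‖ ^ 2 := by nlinarith [norm_nonneg z]
  have hx : xZero z ^ 2 * (1 - ‖z‖ ^ 2) = 1 := by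
    unfold xZero
    rw [inv_pow, Real.sq_sqrt h1.le, inv_mul_cancel₀ h1.ne']
  have hpos : 0 < xZero z + 1 := by unfold xZero; positivity
  have hdot : star (eta z) ⬝ᵥ eta z = ((xZero z ^ 2 - 1 : ℝ) : ℂ) := by
    have : xZero z ^ 2 - 1 = xZero z ^ 2 * ∑ i, ‖z i‖ ^ 2 := by
      rw [← EuclideanSpace.norm_sq_eq]; linarith
    rw [this]
    simp only [dotProduct, eta, Pi.star_apply, star_mul', star_star]
    push_cast
    rw [Finset.mul_sum]
    refine Finset.sum_congr rfl fun i _ => ?_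
    rw [← Complex.mul_conj']
    simp
    ring
  have hc : ((xZero z + 1 : ℝ) : ℂ) ≠ 0 := by exact_mod_cast hpos.ne'
  have hV : Matrix.vecMulVec (eta z) (star (eta z)) * Matrix.vecMulVec (eta z) (star (eta z)) =
      ((xZero z ^ 2 - 1 : ℝ) : ℂ) • Matrix.vecMulVec (eta z) (star (eta z)) := by
    rw [Matrix.vecMulVec_mul_vecMulVec, hdot, Matrix.vecMulVec_smul]
  unfold xOne
  generalize Matrix.vecMulVec (eta z) (star (eta z)) = V at hV
  simp only [mul_add, add_mul, one_mul, mul_one, smul_mul_assoc, mul_smul_comm, hV, smul_smul,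
    smul_add]
  rw [add_assoc, ← add_smul, ← add_smul]
  congr 1
  conv_rhs => rw [← one_smul ℂ V]
  congr 1
  push_cast at hc ⊢
  field_simp
  ring

/-- The isometric automorphism `Ψ` of `𝒜_u` is the bigraded automorphism `Ψ_{A,B}`. -/
def IsPsi (u : Matrix.unitaryGroup (Fin n × Fin m) ℂ) (A : Matrix (Fin n) (Fin n) ℂ)
    (B : Matrix (Fin m) (Fin m) ℂ) (Ψ : algA u ≃ₐ[ℂ] algA u) : Prop :=
  Isometry Ψ ∧ (∀ i, Ψ (genE u i) = ∑ j, A i j • genE u j) ∧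
    ∀ k, Ψ (genF u k) = ∑ l, B k l • genF u l

/-- The isometric automorphism `Ψ` of `𝒜_u` is, when `n = m`, the graded exchange automorphism
`Ψ̃_{A,B}`. -/
def IsPsiTilde (u : Matrix.unitaryGroup (Fin n × Fin n) ℂ) (A B : Matrix (Fin n) (Fin n) ℂ)
    (Ψ : algA u ≃ₐ[ℂ] algA u) : Prop :=
  Isometry Ψ ∧ (∀ i, Ψ (genE u i) = ∑ j, A i j • genF u j) ∧
    ∀ k, Ψ (genF u k) = ∑ l, B k l • genE u l

/-- For a tuple `L = (L₁, …, L_d)` of operators and a point `z` of the open unit ball, the `i`-th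
member `(x₀ I - L_η)⁻¹ (L_{X₁ e_i} - ⟨e_i, η⟩ I)` of the transformed tuple, where
`L_ζ = ∑ ζ_t L_t`. -/
def mobius {d : ℕ} {H : Type*} [NormedAddCommGroup H] [InnerProductSpace ℂ H]
    (L : Fin d → H →L[ℂ] H) (z : EuclideanSpace ℂ (Fin d)) (i : Fin d) : H →L[ℂ] H :=
  Ring.inverse ((xZero z : ℂ) • 1 - ∑ t, eta z t • L t) *
    ((∑ t, xOne z t i • L t) - star (eta z i) • 1)

/-- The isometric automorphism `Θ` of `𝒜_u` is `Θ_{z,w}`. The sign is the one for which the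
composition of the vacuum character with `Θ⁻¹` is the character given by `(z, w)`. -/
def IsTheta (u : Matrix.unitaryGroup (Fin n × Fin m) ℂ) (z : EuclideanSpace ℂ (Fin n))
    (w : EuclideanSpace ℂ (Fin m)) (Θ : algA u ≃ₐ[ℂ] algA u) : Prop :=
  Isometry Θ ∧ (∀ i, (Θ (genE u i) : Fock n m →L[ℂ] Fock n m) = mobius Le z i) ∧
    ∀ j, (Θ (genF u j) : Fock n m →L[ℂ] Fock n m) = mobius (Lf u) w j

/-- The matrix `ũ` with `ũ_{(i,j),(k,l)} = conj(u_{(l,k),(j,i)})`. -/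
def tilde (u : Matrix.unitaryGroup (Fin n × Fin n) ℂ) :
    Matrix (Fin n × Fin n) (Fin n × Fin n) ℂ :=
  Matrix.of fun p q => star (u.1 (q.2, q.1) (p.2, p.1))

end UnitaryRelation

end

open scoped Kronecker

noncomputable section

namespace UnitaryRelation

/-! ### Tuples of operators -/

section Tuples

variable {H : Type*} [NormedAddCommGroup H] [InnerProductSpace ℂ H]

/-! The proof has two halves: a recipe that produces isometric automorphisms, and a study of where
an automorphism moves the vacuum character `a ↦ ⟨Ω, a Ω⟩`.

Recipe (`exists_automorphism`). Let `T`, `S` be row isometries in `𝒜_u` that satisfy the relations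
of `u` and have a wandering unit vector `ω`. The words `T_a S_b ω` are then orthonormal, so `e_a ⊗
f_b ↦ T_a S_b ω` is an isometry that intertwines the shifts with `T`, `S`. If `T`, `S` generate the
shifts and `Ω` is reached from `ω`, this isometry is onto, and conjugation by it is the
automorphism. For `Ψ` and `Ψ̃` the tuples are unitary combinations of shifts and `ω = Ω`. For `Θ`
they are Möbius transforms: `x₀`, `η`, `X₁` are the entries of a matrix that preserves the form of
signature `(1, d)`, which makes the transforms row isometric and invertible by a formula of the same
kind. The core equations say that `u` fixes `z ⊗ F` and `E ⊗ w`, so the resolvents commute with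
everything needed to preserve the relations.

Classification. Composing the vacuum character with an isometric automorphism `Φ` gives a character
whose values on the generators are, up to sign, a pair `(z, w)`. It lies in the open balls because
`Ω` separates `𝒜_u` (`ext_vac`). It lies in the core because the point derivations at the new
character still take arbitrary values on the generators, and such a derivation turns the quadratic
relations into the linear core equations. Dividing by `Θ_{z,w}` leaves an automorphism `Ψ` that
fixes the vacuum character. Its matrix `M` of linear parts and that of its inverse are mutually
inverse with rows of norm at most one, hence unitary. Norms then leave no room for terms of higher
degree, so `Ψ` acts linearly on the generators.

It remains to see that `M` respects the splitting `E ⊕ F`. The vectors `(z, w)` with `u (z ⊗ w) = z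
⊗ w` are, up to scaling, the values of characters, so `M` preserves this set and the norm `max (‖z‖,
‖w‖)` on it. Since `M` also preserves `‖z‖² + ‖w‖²`, a vector of the set with one component zero
goes to another such vector. Hence `M` is block diagonal or, when `n = m`, block antidiagonal.
Comparing coefficients of degree two gives the condition on `A ⊗ B`. -/

/-- The members of the tuple are isometries with pairwise orthogonal ranges. -/
def RowIsometric {d : ℕ} (L : Fin d → H →L[ℂ] H) : Prop :=
  ∀ i j x y, inner ℂ (L i x) (L j y) = if i = j then (inner ℂ x y : ℂ) else 0

theorem RowIsometric.norm_sum_apply_sq {d : ℕ} {L : Fin d → H →L[ℂ] H} (hL : RowIsometric L)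
    (c : Fin d → ℂ) (x : H) :
    ‖(∑ t, c t • L t) x‖ ^ 2 = (∑ t, ‖c t‖ ^ 2) * ‖x‖ ^ 2 := by
  have h : inner ℂ ((∑ t, c t • L t) x) ((∑ t, c t • L t) x) =
      (∑ t, star (c t) * c t) * (inner ℂ x x : ℂ) := by
    simp only [sum_apply, smul_apply, sum_inner, inner_sum,
      inner_smul_left, inner_smul_right, hL _ _ _ _, Finset.sum_mul]
    simp [mul_assoc, mul_left_comm]
  rw [inner_self_eq_norm_sq_to_K, inner_self_eq_norm_sq_to_K] at h
  have h2 : ∀ t, star (c t) * c t = ((‖c t‖ ^ 2 : ℝ) : ℂ) := by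
    intro t
    rw [mul_comm]
    simpa using Complex.mul_conj' (c t)
  simp only [h2, Complex.coe_algebraMap] at h
  exact_mod_cast h

theorem RowIsometric.norm_sum_le {d : ℕ} {L : Fin d → H →L[ℂ] H} (hL : RowIsometric L)
    (c : Fin d → ℂ) : ‖∑ t, c t • L t‖ ≤ √(∑ t, ‖c t‖ ^ 2) := by
  refine ContinuousLinearMap.opNorm_le_bound _ (Real.sqrt_nonneg _) fun x => ?_
  refine (sq_le_sq₀ (norm_nonneg _) (by positivity)).1 ?_
  rw [hL.norm_sum_apply_sq, mul_pow, Real.sq_sqrt (by positivity)]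

/-- Operators that map a closed subspace into itself form a closed subalgebra, so it is enough to
test generators. -/
theorem stabilizes_of_mem_closure (K : Submodule ℂ H) (hK : IsClosed (K : Set H))
    (s : Set (H →L[ℂ] H)) (hs : ∀ a ∈ s, ∀ x ∈ K, a x ∈ K) {a : H →L[ℂ] H}
    (ha : a ∈ (Algebra.adjoin ℂ s).topologicalClosure) {x : H} (hx : x ∈ K) : a x ∈ K := by
  let St : Subalgebra ℂ (H →L[ℂ] H) :=
    { carrier := {a | ∀ x ∈ K, a x ∈ K}
      mul_mem' := fun ha hb x hx => ha _ (hb x hx)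
      add_mem' := fun ha hb x hx => K.add_mem (ha x hx) (hb x hx)
      algebraMap_mem' := fun r x hx => by
        simpa [Algebra.algebraMap_eq_smul_one] using K.smul_mem r hx }
  have hcl : IsClosed (St : Set (H →L[ℂ] H)) := by
    have : (St : Set (H →L[ℂ] H)) = ⋂ x ∈ K, {a | a x ∈ K} := by
      ext a
      simp only [Set.mem_iInter, Set.mem_ofPred_eq]
      rfl
    rw [this]
    exact isClosed_biInter fun x _ =>
      hK.preimage (ContinuousLinearMap.apply ℂ H x).continuous
  exact Subalgebra.topologicalClosure_minimal (Algebra.adjoin_le (S := St) hs) hcl ha x hx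

/-- The Neumann series converges inside the closed subalgebra `C`. Knowing that the inverse stays in
`C` is what later confines a resolvent to the algebra of a single tuple. -/
theorem exists_inverse_mem [CompleteSpace H] (C : Subalgebra ℂ (H →L[ℂ] H))
    (hC : IsClosed (C : Set (H →L[ℂ] H))) {a : H →L[ℂ] H} (ha : a ∈ C) {c : ℂ} (h : ‖a‖ < ‖c‖) :
    ∃ v ∈ C, v * (c • 1 - a) = 1 ∧ (c • 1 - a) * v = 1 := by
  have hc : c ≠ 0 := fun h0 => by
    rw [h0, norm_zero] at h
    exact absurd h (norm_nonneg a).not_gt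
  have hC' : IsClosed (C.toSubmodule : Set (H →L[ℂ] H)) := hC
  have : CompleteSpace C := hC.completeSpace_coe
  have hlt : ‖(⟨c⁻¹ • a, C.smul_mem ha _⟩ : C)‖ < 1 := by
    change ‖c⁻¹ • a‖ < 1
    rw [norm_smul, norm_inv, inv_mul_lt_iff₀ (norm_pos_iff.2 hc)]
    simpa using h
  let U := Units.oneSub (⟨c⁻¹ • a, C.smul_mem ha _⟩ : C) hlt
  have hU : ((U : C) : H →L[ℂ] H) = 1 - c⁻¹ • a := by simp [U]
  have hUc : c • 1 - a = c • ((U : C) : H →L[ℂ] H) := by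
    rw [hU, smul_sub, smul_smul, mul_inv_cancel₀ hc, one_smul]
  have h1 : (((U⁻¹ : Cˣ) : C) : H →L[ℂ] H) * ((U : C) : H →L[ℂ] H) = 1 :=
    congrArg (Subtype.val : C → H →L[ℂ] H) U.inv_mul
  have h2 : ((U : C) : H →L[ℂ] H) * (((U⁻¹ : Cˣ) : C) : H →L[ℂ] H) = 1 :=
    congrArg (Subtype.val : C → H →L[ℂ] H) U.mul_inv
  refine ⟨c⁻¹ • (((U⁻¹ : Cˣ) : C) : H →L[ℂ] H), C.smul_mem (Subtype.mem _) _, ?_, ?_⟩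
  · rw [hUc, smul_mul_smul_comm, inv_mul_cancel₀ hc, one_smul, h1]
  · rw [hUc, smul_mul_smul_comm, mul_inv_cancel₀ hc, one_smul, h2]

end Tuples

variable {n m : ℕ}

/-- The tuples `T` and `S` satisfy the commutation relations given by `u`. -/
def Relation {R : Type*} [Semiring R] [Algebra ℂ R]
    (u : Matrix.unitaryGroup (Fin n × Fin m) ℂ) (T : Fin n → R) (S : Fin m → R) : Prop :=
  ∀ i j, T i * S j = ∑ k, ∑ l, u.1 (i, j) (k, l) • (S l * T k)

/-! ### Reversing the order of multiplication in the relations -/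

section Relations

variable {R : Type*} [Semiring R] [Algebra ℂ R] {u : Matrix.unitaryGroup (Fin n × Fin m) ℂ}
  {T : Fin n → R} {S : Fin m → R}

theorem sum_star_mul (u : Matrix.unitaryGroup (Fin n × Fin m) ℂ) (p q : Fin n × Fin m) :
    ∑ r, star (u.1 r p) * u.1 r q = if p = q then 1 else 0 := by
  have h := congrFun (congrFun (Matrix.mem_unitaryGroup_iff'.1 u.2) p) q
  rw [Matrix.mul_apply, Matrix.one_apply] at h
  simpa only [Matrix.star_apply] using h

theorem sum_mul_star (u : Matrix.unitaryGroup (Fin n × Fin m) ℂ) (p q : Fin n × Fin m) :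
    ∑ r, u.1 p r * star (u.1 q r) = if p = q then 1 else 0 := by
  have h := congrFun (congrFun (Matrix.mem_unitaryGroup_iff.1 u.2) p) q
  rw [Matrix.mul_apply, Matrix.one_apply] at h
  simpa only [Matrix.star_apply] using h

theorem Relation.swap (h : Relation u T S) (k : Fin n) (l : Fin m) :
    S l * T k = ∑ i, ∑ j, star (u.1 (i, j) (k, l)) • (T i * S j) := by
  simp only [h _ _, Finset.smul_sum, smul_smul]
  simp only [← Fintype.sum_prod_type' (f := fun i j => ∑ k' : Fin n, ∑ l' : Fin m,
    (star (u.1 (i, j) (k, l)) * u.1 (i, j) (k', l')) • (S l' * T k'))]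
  rw [Finset.sum_comm]
  simp only [Finset.sum_comm (s := (Finset.univ : Finset (Fin n × Fin m))), ← Finset.sum_smul]
  simp only [Prod.mk.eta, sum_star_mul, Prod.mk.injEq, ite_and]
  simp

theorem Relation.of_swap
    (h : ∀ k l, S l * T k = ∑ i, ∑ j, star (u.1 (i, j) (k, l)) • (T i * S j)) :
    Relation u T S := by
  intro i j
  simp only [h _ _, Finset.smul_sum, smul_smul]
  simp only [← Fintype.sum_prod_type' (f := fun k l => ∑ i' : Fin n, ∑ j' : Fin m,
    (u.1 (i, j) (k, l) * star (u.1 (i', j') (k, l))) • (T i' * S j'))]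
  rw [Finset.sum_comm]
  simp only [Finset.sum_comm (s := (Finset.univ : Finset (Fin n × Fin m))), ← Finset.sum_smul]
  simp only [Prod.mk.eta, sum_mul_star, Prod.mk.injEq, ite_and]
  simp

end Relations

/-! ### The shifts on the Fock space -/

/-- The vacuum vector. -/
def vac : Fock n m := ket ([], [])

theorem norm_ket (p : List (Fin n) × List (Fin m)) : ‖ket p‖ = 1 := orthonormal_ket.1 p

theorem norm_vac : ‖(vac : Fock n m)‖ = 1 := norm_ket _

theorem hasSum_ket (x : Fock n m) : HasSum (fun p => x p • ket p) x := by
  convert lp.hasSum_single ENNReal.ofNat_ne_top x using 2 with p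
  simp [ket, ← lp.single_smul]

theorem ext_ket {G : Type*} [AddCommMonoid G] [TopologicalSpace G] [T2Space G] [Module ℂ G]
    {A B : Fock n m →L[ℂ] G} (h : ∀ p, A (ket p) = B (ket p)) : A = B := by
  ext x
  have hA := (hasSum_ket x).mapL A
  have hB := (hasSum_ket x).mapL B
  simp only [map_smul, h] at hA hB
  exact hA.unique hB

theorem inner_ket_left (p : List (Fin n) × List (Fin m)) (x : Fock n m) :
    inner ℂ (ket p) x = x p := by
  simp [ket, lp.inner_single_left]

theorem mem_of_ket_mem (K : Submodule ℂ (Fock n m)) (hK : IsClosed (K : Set (Fock n m)))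
    (h : ∀ p, ket p ∈ K) (x : Fock n m) : x ∈ K :=
  hK.mem_of_tendsto (hasSum_ket x) (.of_forall fun _ =>
    K.sum_mem fun p _ => K.smul_mem _ (h p))

theorem Le_ket (i : Fin n) (p : List (Fin n) × List (Fin m)) :
    Le i (ket p) = ket (i :: p.1, p.2) :=
  isometryOf_ket _ (orthonormal_eVec i) p

theorem Lf_ket (u : Matrix.unitaryGroup (Fin n × Fin m) ℂ) (l : Fin m)
    (p : List (Fin n) × List (Fin m)) : Lf u l (ket p) = fVec u p.1 p.2 l :=
  isometryOf_ket _ (orthonormal_fVec u l) p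

/-- The recursion that defines `fVec` is the relation in its swapped form, read on basis vectors. -/
theorem relation_shifts (u : Matrix.unitaryGroup (Fin n × Fin m) ℂ) :
    Relation u (Le (m := m)) (Lf u) := by
  refine Relation.of_swap fun k l => ext_ket fun p => ?_
  simp only [mul_apply_eq_comp, Le_ket, Lf_ket, sum_apply,
    smul_apply, fVec]
  rfl

theorem rowIsometric_Le : RowIsometric (Le : Fin n → Fock n m →L[ℂ] Fock n m) :=
  fun i j x y => inner_eIso_eIso i j x y

/-- Sesquilinear identities between bounded operators hold once they hold on the basis. -/
theorem inner_apply_ext {A B : Fock n m →L[ℂ] Fock n m} {c : ℂ}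
    (h : ∀ p q, inner ℂ (A (ket p)) (B (ket q)) = c * inner ℂ (ket p) (ket q)) (x y : Fock n m) :
    inner ℂ (A x) (B y) = c * inner ℂ x y := by
  have h1 : ∀ p y, inner ℂ (A (ket p)) (B y) = c * inner ℂ (ket p) y := by
    intro p y
    have := ext_ket (A := (innerSL ℂ (A (ket p))).comp B) (B := c • innerSL ℂ (ket p))
      (fun q => by simpa using h p q)
    simpa using DFunLike.congr_fun this y
  have := ext_ket (A := (innerSL ℂ (B y)).comp A) (B := star c • innerSL ℂ y) (fun q => by
    have h2 := congrArg star (h1 q y)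
    simpa [mul_comm] using h2)
  have h3 := congrArg star (DFunLike.congr_fun this x)
  simpa [mul_comm] using h3

theorem rowIsometric_Lf (u : Matrix.unitaryGroup (Fin n × Fin m) ℂ) : RowIsometric (Lf u) := by
  intro i j x y
  have := inner_apply_ext (A := Lf u i) (B := Lf u j) (c := if i = j then 1 else 0) (fun p q => by
    rw [Lf_ket, Lf_ket, inner_fVec, inner_ket]
    by_cases hij : i = j <;> simp [hij, Prod.ext_iff]) x y
  rw [this]
  split_ifs <;> simp

theorem inner_Le_ket_nil (i : Fin n) (x : Fock n m) (b : List (Fin m)) :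
    inner ℂ (Le i x) (ket ([], b)) = (0 : ℂ) :=
  inner_eIso_ket_nil i x b

/-- Moving `f_l` to the right through the letters of `E` only replaces it by other letters of `F`,
so no pure word in `E` can occur. -/
theorem inner_fVec_ket_nil (u : Matrix.unitaryGroup (Fin n × Fin m) ℂ) (b : List (Fin m)) :
    ∀ (a a' : List (Fin n)) (l : Fin m), inner ℂ (fVec u a b l) (ket (a', [])) = (0 : ℂ)
  | [], a', l => by simp [fVec, inner_ket]
  | k :: a, [], l => by simp [fVec, inner_eIso_ket_nil]
  | k :: a, k' :: a', l => by
    have h : (ket (k' :: a', []) : Fock n m) = eIso k' (ket (a', [])) := (Le_ket k' (a', [])).symm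
    simp [fVec, h, inner_eIso_eIso, inner_fVec_ket_nil u b a a']

theorem inner_Lf_ket_nil (u : Matrix.unitaryGroup (Fin n × Fin m) ℂ) (l : Fin m) (x : Fock n m)
    (a : List (Fin n)) : inner ℂ (Lf u l x) (ket (a, [])) = (0 : ℂ) := by
  have := ext_ket (A := (innerSL ℂ (ket (a, []))).comp (Lf u l)) (B := 0) (fun q => by
    have h := congrArg star (inner_fVec_ket_nil u q.2 q.1 a l)
    simpa [Lf_ket] using h)
  have h3 := congrArg star (DFunLike.congr_fun this x)
  simpa using h3

/-- The product of the operators of a tuple along a word. -/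
def word {d : ℕ} {R : Type*} [Monoid R] (T : Fin d → R) (a : List (Fin d)) : R := (a.map T).prod

@[simp] theorem word_nil {d : ℕ} {R : Type*} [Monoid R] (T : Fin d → R) : word T [] = 1 := rfl

@[simp] theorem word_cons {d : ℕ} {R : Type*} [Monoid R] (T : Fin d → R) (i : Fin d)
    (a : List (Fin d)) : word T (i :: a) = T i * word T a := by
  simp [word]

theorem word_mem {R : Type*} [Semiring R] [Algebra ℂ R] (C : Subalgebra ℂ R) {d : ℕ}
    {L : Fin d → R} (hL : ∀ i, L i ∈ C) (a : List (Fin d)) : word L a ∈ C := by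
  induction a with
  | nil => simp [C.one_mem]
  | cons i a ih => simpa using C.mul_mem (hL i) ih

/-- The operator `L_{e_a} L_{f_b}` for words `a` and `b`. -/
def monomial (u : Matrix.unitaryGroup (Fin n × Fin m) ℂ) (p : List (Fin n) × List (Fin m)) :
    Fock n m →L[ℂ] Fock n m :=
  word Le p.1 * word (Lf u) p.2

theorem word_Lf_vac (u : Matrix.unitaryGroup (Fin n × Fin m) ℂ) (b : List (Fin m)) :
    word (Lf u) b vac = ket ([], b) := by
  induction b with
  | nil => rfl
  | cons l b ih => simp [ih, Lf_ket, fVec]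

theorem monomial_vac (u : Matrix.unitaryGroup (Fin n × Fin m) ℂ)
    (p : List (Fin n) × List (Fin m)) : monomial u p vac = ket p := by
  obtain ⟨a, b⟩ := p
  simp only [monomial, mul_apply_eq_comp, word_Lf_vac]
  induction a with
  | nil => rfl
  | cons l b ih => simp [ih, Le_ket]

/-! ### The algebra -/

theorem isClosed_algA (u : Matrix.unitaryGroup (Fin n × Fin m) ℂ) :
    IsClosed (algA u : Set (Fock n m →L[ℂ] Fock n m)) :=
  Subalgebra.isClosed_topologicalClosure _

theorem algA_le_of_isClosed {u : Matrix.unitaryGroup (Fin n × Fin m) ℂ}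
    {C : Subalgebra ℂ (Fock n m →L[ℂ] Fock n m)} (hC : IsClosed (C : Set (Fock n m →L[ℂ] Fock n m)))
    (he : ∀ i, Le i ∈ C) (hf : ∀ j, Lf u j ∈ C) : algA u ≤ C := by
  refine Subalgebra.topologicalClosure_minimal (Algebra.adjoin_le ?_) hC
  rintro _ (⟨i, rfl⟩ | ⟨j, rfl⟩)
  exacts [he i, hf j]

theorem eq_top_of_isClosed {u : Matrix.unitaryGroup (Fin n × Fin m) ℂ}
    (C : Subalgebra ℂ (algA u)) (hC : IsClosed (C : Set (algA u)))
    (he : ∀ i, genE u i ∈ C) (hf : ∀ j, genF u j ∈ C) : C = ⊤ := by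
  have hcl : IsClosed ((C.map (algA u).val : Subalgebra ℂ _) : Set (Fock n m →L[ℂ] Fock n m)) :=
    (isClosed_algA u).isClosedMap_subtype_val _ hC
  have h := algA_le_of_isClosed (u := u) hcl (fun i => ⟨_, he i, rfl⟩) (fun j => ⟨_, hf j, rfl⟩)
  refine eq_top_iff.2 fun a _ => ?_
  obtain ⟨b, hb, hba⟩ := h a.2
  rwa [← Subtype.ext hba]

theorem algHom_ext {u : Matrix.unitaryGroup (Fin n × Fin m) ℂ} {B : Type*} [Semiring B]
    [Algebra ℂ B] [TopologicalSpace B] [T2Space B] {φ ψ : algA u →ₐ[ℂ] B} (hφ : Continuous φ)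
    (hψ : Continuous ψ) (he : ∀ i, φ (genE u i) = ψ (genE u i))
    (hf : ∀ j, φ (genF u j) = ψ (genF u j)) : φ = ψ := by
  have h := eq_top_of_isClosed (AlgHom.equalizer φ ψ) (isClosed_eq hφ hψ) he hf
  ext a
  exact (h ▸ Algebra.mem_top : a ∈ AlgHom.equalizer φ ψ)

instance (u : Matrix.unitaryGroup (Fin n × Fin m) ℂ) : CompleteSpace (algA u) :=
  (isClosed_algA u).completeSpace_coe

/-! ### Isometric automorphisms from tuples -/

section Implementation

variable {u : Matrix.unitaryGroup (Fin n × Fin m) ℂ}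
  {T : Fin n → Fock n m →L[ℂ] Fock n m} {S : Fin m → Fock n m →L[ℂ] Fock n m} {ω : Fock n m}

/-- Equal first letters are stripped by the isometry property and different ones are orthogonal.
When one word runs out first, the wandering hypotheses on `ω` give zero. -/
theorem orthonormal_word (hT : RowIsometric T) (hS : RowIsometric S) (hω : ‖ω‖ = 1)
    (hTω : ∀ i x b, inner ℂ (T i x) (word S b ω) = (0 : ℂ))
    (hSω : ∀ j x, inner ℂ (S j x) ω = (0 : ℂ)) :
    Orthonormal ℂ fun p : List (Fin n) × List (Fin m) => word T p.1 (word S p.2 ω) := by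
  have hSS : ∀ b b' : List (Fin m),
      inner ℂ (word S b ω) (word S b' ω) = if b = b' then (1 : ℂ) else 0 := by
    intro b
    induction b with
    | nil =>
      intro b'
      cases b' with
      | nil => simp [hω]
      | cons l b' =>
        rw [← inner_conj_symm]
        simp [mul_apply_eq_comp, hSω]
    | cons l b ih =>
      intro b'
      cases b' with
      | nil => simp [mul_apply_eq_comp, hSω]
      | cons l' b' =>
        simp [mul_apply_eq_comp, hS _ _ _ _, ih, ite_and]
  rw [orthonormal_iff_ite]
  rintro ⟨a, b⟩ ⟨a', b'⟩
  induction a generalizing a' with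
  | nil =>
    cases a' with
    | nil => simp [hSS]
    | cons k a' =>
      rw [← inner_conj_symm]
      simp [mul_apply_eq_comp, hTω]
  | cons k a ih =>
    cases a' with
    | nil => simp [mul_apply_eq_comp, hTω]
    | cons k' a' =>
      have := ih a'
      simp only [Prod.mk.injEq] at this
      simp only [word_cons, mul_apply_eq_comp, hT _ _ _ _, this, Prod.mk.injEq, List.cons.injEq]
      by_cases h : k = k' <;> simp [h]

/-- Commutation with `Le` is built into the choice of basis images. For `Lf`, both `fVec` and the
swapped relation of `T`, `S` move a letter of `F` to the right by the same coefficients. -/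
theorem exists_intertwiner (hrel : Relation u T S)
    (ho : Orthonormal ℂ fun p : List (Fin n) × List (Fin m) => word T p.1 (word S p.2 ω)) :
    ∃ W : Fock n m →ₗᵢ[ℂ] Fock n m, W vac = ω ∧ (∀ i x, W (Le i x) = T i (W x)) ∧
      ∀ j x, W (Lf u j x) = S j (W x) := by
  let W := isometryOf _ ho
  have hW : ∀ p, W (ket p) = word T p.1 (word S p.2 ω) := isometryOf_ket _ ho
  have hWe : ∀ i x, W (Le i x) = T i (W x) := by
    intro i x
    have := ext_ket (A := W.toContinuousLinearMap.comp (Le i))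
      (B := (T i).comp W.toContinuousLinearMap) (fun p => by
        simp [Le_ket, hW, mul_apply_eq_comp])
    simpa using DFunLike.congr_fun this x
  refine ⟨W, by simp [vac, hW], hWe, ?_⟩
  intro j x
  have hf : ∀ (a : List (Fin n)) (b : List (Fin m)) (l : Fin m),
      W (fVec u a b l) = S l (word T a (word S b ω)) := by
    intro a b
    induction a with
    | nil => intro l; simp [fVec, hW, mul_apply_eq_comp]
    | cons k a ih =>
      intro l
      have h1 : ∀ i x, W (eIso i x) = T i (W x) := hWe
      have h2 := DFunLike.congr_fun (hrel.swap k l) (word T a (word S b ω))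
      simp only [mul_apply_eq_comp, sum_apply, smul_apply] at h2
      simp only [fVec, map_sum, map_smul, h1, ih, word_cons, mul_apply_eq_comp, h2]
  have := ext_ket (A := W.toContinuousLinearMap.comp (Lf u j))
    (B := (S j).comp W.toContinuousLinearMap) (fun p => by
      simp [Lf_ket, hW, hf])
  simpa using DFunLike.congr_fun this x

/-- The range of the intertwiner `W` is closed, invariant under `C` and contains `ω`, hence contains
`vac`; since `C` contains the shifts, it then contains every basis vector. So `W` is unitary, and
conjugation by it carries the shifts to `T`, `S` and `algA u` onto `C = algA u`. -/
theorem exists_automorphism (hT : RowIsometric T) (hS : RowIsometric S) (hrel : Relation u T S)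
    (hω : ‖ω‖ = 1) (hTω : ∀ i x b, inner ℂ (T i x) (word S b ω) = (0 : ℂ))
    (hSω : ∀ j x, inner ℂ (S j x) ω = (0 : ℂ))
    (hTmem : ∀ i, T i ∈ algA u) (hSmem : ∀ j, S j ∈ algA u)
    {C : Subalgebra ℂ (Fock n m →L[ℂ] Fock n m)}
    (hC : C = (Algebra.adjoin ℂ (Set.range T ∪ Set.range S)).topologicalClosure)
    (hLe : ∀ i, Le i ∈ C) (hLf : ∀ j, Lf u j ∈ C) (hvac : ∃ c ∈ C, c ω = vac) :
    ∃ Φ : algA u ≃ₐ[ℂ] algA u, Isometry Φ ∧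
      (∀ i, (Φ (genE u i) : Fock n m →L[ℂ] Fock n m) = T i) ∧
      ∀ j, (Φ (genF u j) : Fock n m →L[ℂ] Fock n m) = S j := by
  obtain ⟨W, hW0, hWe, hWf⟩ := exists_intertwiner hrel (orthonormal_word hT hS hω hTω hSω)
  have hcl : IsClosed (LinearMap.range W.toLinearMap : Set (Fock n m)) := by
    rw [LinearMap.coe_range]
    exact W.isometry.isClosedEmbedding.isClosed_range
  have hstab : ∀ c ∈ C, ∀ x ∈ LinearMap.range W.toLinearMap,
      c x ∈ LinearMap.range W.toLinearMap := by
    intro c hc x hx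
    rw [hC] at hc
    refine stabilizes_of_mem_closure _ hcl _ ?_ hc hx
    rintro _ (⟨i, rfl⟩ | ⟨j, rfl⟩) _ ⟨y, rfl⟩
    · exact ⟨Le i y, hWe i y⟩
    · exact ⟨Lf u j y, hWf j y⟩
  have hvac' : vac ∈ LinearMap.range W.toLinearMap := by
    obtain ⟨c, hc, h⟩ := hvac
    rw [← h]
    exact hstab c hc _ ⟨vac, hW0⟩
  have hle : algA u ≤ C := algA_le_of_isClosed
    (hC ▸ Subalgebra.isClosed_topologicalClosure _) hLe hLf
  have hge : C ≤ algA u := by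
    rw [hC]
    refine Subalgebra.topologicalClosure_minimal (Algebra.adjoin_le ?_) (isClosed_algA u)
    rintro _ (⟨i, rfl⟩ | ⟨j, rfl⟩)
    exacts [hTmem i, hSmem j]
  have hsurj : Function.Surjective W := by
    intro x
    refine mem_of_ket_mem (LinearMap.range W.toLinearMap) hcl (fun p => ?_) x
    rw [← monomial_vac u p]
    exact hstab _ (C.mul_mem (word_mem C hLe _) (word_mem C hLf _)) _ hvac'
  let E := LinearIsometryEquiv.ofSurjective W hsurj
  have hE : ∀ x, E x = W x := fun _ => rfl
  let K : (Fock n m →L[ℂ] Fock n m) ≃A[ℂ] (Fock n m →L[ℂ] Fock n m) :=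
    E.toContinuousLinearEquiv.conjContinuousAlgEquiv
  have hK : ∀ a x, K a x = E (a (E.symm x)) := fun a x => rfl
  have hKe : ∀ i, K (Le i) = T i := by
    intro i
    ext1 x
    rw [hK, hE, hWe, ← hE, E.apply_symm_apply]
  have hKf : ∀ j, K (Lf u j) = S j := by
    intro i
    ext1 x
    rw [hK, hE, hWf, ← hE, E.apply_symm_apply]
  -- Conjugation is a homeomorphism, so it commutes with closing the generated algebra.
  have hmap : (algA u).map (K.toAlgEquiv : (Fock n m →L[ℂ] Fock n m) →ₐ[ℂ] _) = algA u := by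
    let K' : (Fock n m →L[ℂ] Fock n m) →A[ℂ] (Fock n m →L[ℂ] Fock n m) :=
      ⟨(K.toAlgEquiv : (Fock n m →L[ℂ] Fock n m) →ₐ[ℂ] _), K.continuous⟩
    have h1 := Subalgebra.topologicalClosure_map K'
      K.toHomeomorph.isClosedMap (Algebra.adjoin ℂ (Set.range Le ∪ Set.range (Lf u)))
    rw [AlgHom.map_adjoin, Set.image_union, ← Set.range_comp, ← Set.range_comp] at h1
    have h2 : (⇑(K' : (Fock n m →L[ℂ] Fock n m) →ₐ[ℂ] (Fock n m →L[ℂ] Fock n m)) ∘ Le) = T :=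
      funext hKe
    have h3 : (⇑(K' : (Fock n m →L[ℂ] Fock n m) →ₐ[ℂ] (Fock n m →L[ℂ] Fock n m)) ∘ Lf u) = S :=
      funext hKf
    rw [h2, h3, ← hC] at h1
    exact h1.symm.trans (le_antisymm hge hle)
  refine ⟨(K.toAlgEquiv.subalgebraMap (algA u)).trans (Subalgebra.equivOfEq _ _ hmap), ?_,
    hKe, hKf⟩
  refine AddMonoidHomClass.isometry_of_norm _ fun a => ?_
  change ‖K a.1‖ = ‖a.1‖
  refine le_antisymm (ContinuousLinearMap.opNorm_le_bound _ (norm_nonneg _) fun x => ?_)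
    (ContinuousLinearMap.opNorm_le_bound _ (norm_nonneg _) fun x => ?_)
  · rw [hK, E.norm_map]
    exact (a.1.le_opNorm _).trans_eq (by rw [E.symm.norm_map])
  · have := (K a.1).le_opNorm (E x)
    rwa [hK, E.symm_apply_apply, E.norm_map, E.norm_map] at this

end Implementation

/-! ### The transformed tuples -/

section Mobius

variable {H : Type*} [NormedAddCommGroup H] [InnerProductSpace ℂ H] {d : ℕ}
  {z : EuclideanSpace ℂ (Fin d)}

theorem xZero_pos (hz : ‖z‖ < 1) : 0 < xZero z := by
  have : 0 < 1 - ‖z‖ ^ 2 := by nlinarith [norm_nonneg z]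
  unfold xZero
  positivity

theorem sum_norm_eta_sq (hz : ‖z‖ < 1) : ∑ t, ‖eta z t‖ ^ 2 = xZero z ^ 2 - 1 := by
  have h1 : 0 < 1 - ‖z‖ ^ 2 := by nlinarith [norm_nonneg z]
  have hx : xZero z ^ 2 * (1 - ‖z‖ ^ 2) = 1 := by
    unfold xZero
    rw [inv_pow, Real.sq_sqrt h1.le, inv_mul_cancel₀ h1.ne']
  have : xZero z ^ 2 - 1 = xZero z ^ 2 * ∑ i, ‖z i‖ ^ 2 := by
    rw [← EuclideanSpace.norm_sq_eq]; linarith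
  rw [this, Finset.mul_sum]
  refine Finset.sum_congr rfl fun i _ => ?_
  simp [eta, mul_pow]

theorem sum_star_eta_mul_eta (hz : ‖z‖ < 1) :
    ∑ t, star (eta z t) * eta z t = (xZero z : ℂ) ^ 2 - 1 := by
  have h := congrArg (Complex.ofReal) (sum_norm_eta_sq hz)
  push_cast at h
  rw [← h]
  refine Finset.sum_congr rfl fun i _ => ?_
  rw [mul_comm]
  exact Complex.mul_conj' _

/-- Since `‖η‖² = x₀² - 1`, the rank one term contributes `(x₀² - 1) / (x₀ + 1) = x₀ - 1`. -/
theorem xOne_mulVec_eta (hz : ‖z‖ < 1) (i : Fin d) :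
    ∑ t, xOne z i t * eta z t = xZero z * eta z i := by
  have h := sum_star_eta_mul_eta hz
  have hpos := xZero_pos hz
  have hc : (xZero z : ℂ) + 1 ≠ 0 := by
    have : (xZero z + 1 : ℝ) ≠ 0 := by positivity
    exact_mod_cast this
  simp only [xOne, Matrix.add_apply, Matrix.smul_apply, Matrix.vecMulVec_apply, Pi.star_apply,
    add_mul, Finset.sum_add_distrib, smul_eq_mul, Matrix.one_apply, mul_assoc, ← Finset.mul_sum, h]
  simp
  field_simp
  ring

theorem star_xOne (z : EuclideanSpace ℂ (Fin d)) (i j : Fin d) :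
    star (xOne z i j) = xOne z j i := by
  open scoped ComplexOrder in
  have h := (xOne_posSemidef z).isHermitian
  exact h.apply j i

theorem star_eta_vecMul_xOne (hz : ‖z‖ < 1) (i : Fin d) :
    ∑ t, star (eta z t) * xOne z t i = xZero z * star (eta z i) := by
  have h := congrArg star (xOne_mulVec_eta hz i)
  simp only [star_sum, star_mul', star_xOne] at h
  simpa [mul_comm] using h

theorem sum_xOne_mul_xOne (hz : ‖z‖ < 1) (i j : Fin d) :
    ∑ t, xOne z i t * xOne z t j = (if i = j then 1 else 0) + eta z i * star (eta z j) := by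
  have h := congrFun (congrFun (xOne_sq z hz) i) j
  simpa [Matrix.mul_apply, Matrix.one_apply, Matrix.vecMulVec_apply] using h

variable {L : Fin d → H →L[ℂ] H}

theorem norm_sum_eta_lt (hL : RowIsometric L) (hz : ‖z‖ < 1) :
    ‖∑ t, eta z t • L t‖ < ‖(xZero z : ℂ)‖ := by
  refine (hL.norm_sum_le _).trans_lt ?_
  have hpos := xZero_pos hz
  rw [sum_norm_eta_sq hz, Complex.norm_real, Real.norm_of_nonneg hpos.le]
  exact (Real.sqrt_lt' hpos).2 (by linarith)

/-- `v` is the inverse of `x₀ I - L_η`. -/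
structure IsResolvent (L : Fin d → H →L[ℂ] H) (z : EuclideanSpace ℂ (Fin d)) (v : H →L[ℂ] H) :
    Prop where
  left : v * ((xZero z : ℂ) • 1 - ∑ t, eta z t • L t) = 1
  right : ((xZero z : ℂ) • 1 - ∑ t, eta z t • L t) * v = 1

theorem exists_isResolvent [CompleteSpace H] (hL : RowIsometric L) (hz : ‖z‖ < 1)
    (C : Subalgebra ℂ (H →L[ℂ] H)) (hC : IsClosed (C : Set (H →L[ℂ] H))) (hLC : ∀ i, L i ∈ C) :
    ∃ v ∈ C, IsResolvent L z v := by
  obtain ⟨v, hv, h1, h2⟩ := exists_inverse_mem C hC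
    (C.sum_mem fun t _ => C.smul_mem (hLC t) (eta z t)) (norm_sum_eta_lt hL hz)
  exact ⟨v, hv, h1, h2⟩

variable {v : H →L[ℂ] H}

theorem IsResolvent.mobius_eq (hv : IsResolvent L z v) (i : Fin d) :
    mobius L z i = v * ((∑ t, xOne z t i • L t) - star (eta z i) • 1) := by
  unfold mobius
  congr 1
  exact Ring.inverse_unit ⟨_, v, hv.right, hv.left⟩

theorem IsResolvent.mobius_mem (hv : IsResolvent L z v) {C : Subalgebra ℂ (H →L[ℂ] H)}
    (hvC : v ∈ C) (hLC : ∀ i, L i ∈ C) (i : Fin d) : mobius L z i ∈ C := by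
  rw [hv.mobius_eq]
  exact C.mul_mem hvC (C.sub_mem (C.sum_mem fun t _ => C.smul_mem (hLC t) _)
    (C.smul_mem C.one_mem _))

theorem IsResolvent.mul_mobius (hv : IsResolvent L z v) (i : Fin d) :
    ((xZero z : ℂ) • 1 - ∑ t, eta z t • L t) * mobius L z i =
      (∑ t, xOne z t i • L t) - star (eta z i) • 1 := by
  rw [hv.mobius_eq, ← mul_assoc, hv.right, one_mul]

/-- The defining formula with the resolvent cleared and all shifts collected on one side, where
inner products can be computed from row isometry alone. -/
theorem IsResolvent.sum_apply (hv : IsResolvent L z v) (i : Fin d) (x : H) :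
    (xZero z : ℂ) • mobius L z i x + star (eta z i) • x =
      ∑ t, L t (xOne z t i • x + eta z t • mobius L z i x) := by
  have h := DFunLike.congr_fun (hv.mul_mobius i) x
  simp only [mul_apply_eq_comp, sub_apply, smul_apply, one_apply_eq_self, _root_.sum_apply] at h
  simp only [map_add, map_smul, Finset.sum_add_distrib]
  rw [sub_eq_iff_eq_add] at h
  rw [h]
  abel

/-- Inner products of the two sides of `sum_apply` are compared. The identities `X₁² = 1 + ηη*`, `X₁
η = x₀ η` and `‖η‖² = x₀² - 1` cancel everything except the desired relation. -/
theorem IsResolvent.rowIsometric (hv : IsResolvent L z v) (hL : RowIsometric L) (hz : ‖z‖ < 1) :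
    RowIsometric (mobius L z) := by
  intro i j x y
  have h := congrArg₂ (inner ℂ) (hv.sum_apply i x) (hv.sum_apply j y)
  simp only [sum_inner, inner_sum, hL _ _ _ _, Finset.sum_ite_eq', Finset.mem_univ, if_true,
    inner_add_left, inner_add_right, inner_smul_left, inner_smul_right, mul_add,
    Finset.sum_add_distrib] at h
  generalize mobius L z i x = p at h ⊢
  generalize mobius L z j y = q at h ⊢
  have e1 : ∑ t, xOne z t j * ((starRingEnd ℂ) (xOne z t i) * inner ℂ x y) =
      ((if i = j then 1 else 0) + eta z i * star (eta z j)) * inner ℂ x y := by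
    rw [← sum_xOne_mul_xOne hz, Finset.sum_mul]
    refine Finset.sum_congr rfl fun t _ => ?_
    rw [← star_xOne z t i]
    simp; ring
  have e2 : ∑ t, eta z t * ((starRingEnd ℂ) (xOne z t i) * inner ℂ x q) =
      xZero z * eta z i * inner ℂ x q := by
    rw [← xOne_mulVec_eta hz, Finset.sum_mul]
    refine Finset.sum_congr rfl fun t _ => ?_
    rw [← star_xOne z t i]
    simp; ring
  have e3 : ∑ t, xOne z t j * ((starRingEnd ℂ) (eta z t) * inner ℂ p y) =
      xZero z * star (eta z j) * inner ℂ p y := by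
    rw [← star_eta_vecMul_xOne hz, Finset.sum_mul]
    refine Finset.sum_congr rfl fun t _ => ?_
    simp; ring
  have e4 : ∑ t, eta z t * ((starRingEnd ℂ) (eta z t) * inner ℂ p q) =
      ((xZero z : ℂ) ^ 2 - 1) * inner ℂ p q := by
    rw [← sum_star_eta_mul_eta hz, Finset.sum_mul]
    refine Finset.sum_congr rfl fun t _ => ?_
    simp; ring
  rw [e1, e2, e3, e4] at h
  simp at h
  split_ifs with hij <;> simp [hij] at h ⊢ <;> linear_combination h

/-- Multiplying by `x₀ - L_η` gives `x₀² - x₀ L_η + L_{X₁ η} - ‖η‖²`, which is `1`. The resolvent is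
thus affine in the transformed tuple. -/
theorem IsResolvent.eq_add (hv : IsResolvent L z v) (hz : ‖z‖ < 1) :
    v = (xZero z : ℂ) • 1 + ∑ t, eta z t • mobius L z t := by
  have h : ((xZero z : ℂ) • 1 - ∑ t, eta z t • L t) *
      ((xZero z : ℂ) • 1 + ∑ t, eta z t • mobius L z t) = 1 := by
    simp only [mul_add, Finset.mul_sum, mul_smul_comm, mul_one, hv.mul_mobius, smul_sub,
      Finset.sum_sub_distrib, Finset.smul_sum, smul_smul]
    rw [Finset.sum_comm (γ := Fin d)]
    simp only [← Finset.sum_smul, mul_comm (eta z _), xOne_mulVec_eta hz, sum_star_eta_mul_eta hz]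
    rw [sub_smul, one_smul, sq]
    abel
  rw [← left_inv_eq_right_inv hv.left h]

/-- The inverse transformation, by which the original shifts are recovered from the transformed
ones. -/
theorem IsResolvent.tuple_eq (hv : IsResolvent L z v) (hz : ‖z‖ < 1) (i : Fin d) :
    L i = ((xZero z : ℂ) • 1 - ∑ t, eta z t • L t) *
      ((∑ t, xOne z t i • mobius L z t) + star (eta z i) • 1) := by
  simp only [mul_add, Finset.mul_sum, mul_smul_comm, mul_one, hv.mul_mobius, smul_sub,
    Finset.sum_sub_distrib, Finset.smul_sum, smul_smul]
  rw [Finset.sum_comm (γ := Fin d)]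
  simp only [← Finset.sum_smul, mul_comm (xOne z _ i), sum_xOne_mul_xOne hz,
    star_eta_vecMul_xOne hz]
  simp only [add_smul, Finset.sum_add_distrib, ite_smul, one_smul, zero_smul, Finset.sum_ite_eq',
    Finset.mem_univ, if_true, mul_comm (eta z _), mul_comm (xZero z : ℂ)]
  abel

/-- The resolvent carries wandering vectors of `L` to wandering vectors of the transformed tuple: `v
= x₀ + ∑ η_t T_t` reduces the claim to `sum_apply` paired with `ζ`. -/
theorem IsResolvent.inner_mobius (hv : IsResolvent L z v) (hL : RowIsometric L) (hz : ‖z‖ < 1)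
    {ζ : H} (hζ : ∀ i x, inner ℂ (L i x) ζ = (0 : ℂ)) (i : Fin d) (x : H) :
    inner ℂ (mobius L z i x) (v ζ) = (0 : ℂ) := by
  have h := congrArg (fun y => (inner ℂ y ζ : ℂ)) (hv.sum_apply i x)
  simp only [sum_inner, hζ, Finset.sum_const_zero, inner_add_left, inner_smul_left] at h
  rw [hv.eq_add hz]
  simp only [add_apply, smul_apply, one_apply_eq_self, _root_.sum_apply, inner_add_right, inner_sum,
    inner_smul_right, hv.rowIsometric hL hz _ _ _ _]
  simpa using h

end Mobius

/-! ### Linear and affine changes of the tuples -/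

section Change

variable {R : Type*} [Ring R] [Algebra ℂ R] {u : Matrix.unitaryGroup (Fin n × Fin m) ℂ}
  {T : Fin n → R} {S : Fin m → R}

theorem relation_iff : Relation u T S ↔
    ∀ p : Fin n × Fin m, T p.1 * S p.2 = ∑ q, u.1 p q • (S q.2 * T q.1) := by
  simp [Relation, Fintype.sum_prod_type, Prod.forall]

theorem sum_smul_mul_sum_smul (A : Matrix (Fin n) (Fin n) ℂ) (B : Matrix (Fin m) (Fin m) ℂ)
    (T : Fin n → R) (S : Fin m → R) (p : Fin n × Fin m) :
    (∑ t, A p.1 t • T t) * (∑ s, B p.2 s • S s) = ∑ r, (A ⊗ₖ B) p r • (T r.1 * S r.2) := by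
  simp [Fintype.sum_prod_type, Finset.sum_mul_sum, smul_smul, Matrix.kroneckerMap_apply,
    mul_comm (B _ _)]

theorem sum_smul_mul_sum_smul' (A : Matrix (Fin n) (Fin n) ℂ) (B : Matrix (Fin m) (Fin m) ℂ)
    (T : Fin n → R) (S : Fin m → R) (p : Fin n × Fin m) :
    (∑ s, B p.2 s • S s) * (∑ t, A p.1 t • T t) = ∑ r, (A ⊗ₖ B) p r • (S r.2 * T r.1) := by
  rw [Fintype.sum_prod_type, Finset.sum_comm]
  simp [Finset.sum_mul_sum, smul_smul, Matrix.kroneckerMap_apply]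

theorem sum_smul_sum_smul {ι : Type*} [Fintype ι] (M N : Matrix ι ι ℂ) (X : ι → R) (p : ι) :
    ∑ r, M p r • ∑ q, N r q • X q = ∑ q, (M * N) p q • X q := by
  simp only [Finset.smul_sum, smul_smul, Matrix.mul_apply, Finset.sum_smul]
  exact Finset.sum_comm

theorem Relation.linear (h : Relation u T S) {A : Matrix (Fin n) (Fin n) ℂ}
    {B : Matrix (Fin m) (Fin m) ℂ} (hAB : (A ⊗ₖ B) * u.1 = u.1 * (A ⊗ₖ B)) :
    Relation u (fun i => ∑ t, A i t • T t) (fun j => ∑ s, B j s • S s) := by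
  rw [relation_iff] at h ⊢
  intro p
  simp only [sum_smul_mul_sum_smul, sum_smul_mul_sum_smul', h,
    sum_smul_sum_smul _ _ fun q : Fin n × Fin m => S q.2 * T q.1, hAB]

/-- `tilde u` is the adjoint of `u` with the two tensor factors exchanged, so it holds the
coefficients of the swapped relation when `S` is listed first. -/
theorem Relation.swap_tilde {u : Matrix.unitaryGroup (Fin n × Fin n) ℂ} {T S : Fin n → R}
    (h : Relation u T S) (r : Fin n × Fin n) :
    S r.1 * T r.2 = ∑ q, tilde u r q • (T q.2 * S q.1) := by
  rw [h.swap, Fintype.sum_prod_type, Finset.sum_comm]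
  rfl

theorem Relation.linear_swap {u : Matrix.unitaryGroup (Fin n × Fin n) ℂ} {T S : Fin n → R}
    (h : Relation u T S) {A B : Matrix (Fin n) (Fin n) ℂ}
    (hAB : (A ⊗ₖ B) * tilde u = u.1 * (A ⊗ₖ B)) :
    Relation u (fun i => ∑ t, A i t • S t) (fun j => ∑ s, B j s • T s) := by
  rw [relation_iff]
  intro p
  simp only [sum_smul_mul_sum_smul, sum_smul_mul_sum_smul', h.swap_tilde,
    sum_smul_sum_smul _ _ fun q : Fin n × Fin n => T q.2 * S q.1, hAB]

/-- The hypotheses say that `u` fixes `a ⊗ F` and `E ⊗ b`, which makes the terms of degree one and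
zero agree on both sides. -/
theorem Relation.affine (h : Relation u T S) {a : Fin n → ℂ} {b : Fin m → ℂ}
    (ha : ∀ i j l, ∑ k, u.1 (i, j) (k, l) * a k = if j = l then a i else 0)
    (hb : ∀ i j k, ∑ l, u.1 (i, j) (k, l) * b l = if i = k then b j else 0) :
    Relation u (fun i => T i - a i • 1) (fun j => S j - b j • 1) := by
  intro i j
  simp only [sub_mul, mul_sub, smul_mul_assoc, mul_smul_comm, one_mul, mul_one, smul_sub, smul_smul,
    Finset.sum_sub_distrib, ← h i j, mul_comm (b _) (a _)]
  simp only [← mul_assoc]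
  have e1 : ∑ k, ∑ l, (u.1 (i, j) (k, l) * b l) • T k = b j • T i := by
    simp only [← Finset.sum_smul, hb]
    simp
  have e2 : ∑ k, ∑ l, (u.1 (i, j) (k, l) * a k) • S l = a i • S j := by
    rw [Finset.sum_comm]
    simp only [← Finset.sum_smul, ha]
    simp
  have e3 : ∑ k, ∑ l, (u.1 (i, j) (k, l) * a k * b l) • (1 : R) = (a i * b j) • 1 := by
    rw [Finset.sum_comm]
    simp only [← Finset.sum_smul, ← Finset.sum_mul, ha]
    simp
  rw [e1, e2, e3]
  abel

theorem Relation.mul_left (h : Relation u T S) {v v' : R} (hvv : Commute v v')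
    (hv : ∀ j, Commute v (S j)) (hv' : ∀ i, Commute v' (T i)) :
    Relation u (fun i => v * T i) (fun j => v' * S j) := by
  intro i j
  have e1 : ∀ i j, v * T i * (v' * S j) = v * v' * (T i * S j) := by
    intro i j
    rw [mul_assoc, ← mul_assoc (T i), ← (hv' i).eq]
    simp only [mul_assoc]
  have e2 : ∀ i j, v' * S j * (v * T i) = v * v' * (S j * T i) := by
    intro i j
    rw [mul_assoc, ← mul_assoc (S j), ← (hv j).eq, hvv.eq]
    simp only [mul_assoc]
  simp only [e1, e2, h i j, Finset.mul_sum, mul_smul_comm]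

/-- Here `u` fixes `c̄ ⊗ F`. Conjugating this evaluates the sums of `star u` that the swapped
relation produces. -/
theorem Relation.commute_left (h : Relation u T S) {c : Fin n → ℂ}
    (hc : ∀ i j l, ∑ k, u.1 (i, j) (k, l) * star (c k) = if j = l then star (c i) else 0)
    (l : Fin m) : Commute (∑ t, c t • T t) (S l) := by
  have hc' : ∀ i j, ∑ k, c k * star (u.1 (i, j) (k, l)) = if j = l then c i else 0 := by
    intro i j
    have := congrArg star (hc i j l)
    rw [star_sum] at this
    simpa [mul_comm, apply_ite] using this
  refine Commute.symm ?_
  rw [commute_iff_eq]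
  simp only [Finset.mul_sum, Finset.sum_mul, mul_smul_comm, h.swap, Finset.smul_sum, smul_smul,
    smul_mul_assoc]
  rw [Finset.sum_comm]
  refine Finset.sum_congr rfl fun i _ => ?_
  rw [Finset.sum_comm]
  simp only [← Finset.sum_smul, hc']
  simp

theorem Relation.commute_right (h : Relation u T S) {c : Fin m → ℂ}
    (hc : ∀ i j k, ∑ l, u.1 (i, j) (k, l) * star (c l) = if i = k then star (c j) else 0)
    (k : Fin n) : Commute (∑ t, c t • S t) (T k) := by
  have hc' : ∀ i j, ∑ l, c l * star (u.1 (i, j) (k, l)) = if i = k then c j else 0 := by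
    intro i j
    have := congrArg star (hc i j k)
    rw [star_sum] at this
    simpa [mul_comm, apply_ite] using this
  rw [commute_iff_eq]
  simp only [Finset.mul_sum, Finset.sum_mul, mul_smul_comm, h.swap, Finset.smul_sum, smul_smul,
    smul_mul_assoc]
  rw [Finset.sum_comm]
  have e : ∀ i, ∑ l, ∑ j, (c l * star (u.1 (i, j) (k, l))) • (T i * S j) =
      ∑ j, (if i = k then c j else 0) • (T i * S j) := by
    intro i
    rw [Finset.sum_comm]
    simp only [← Finset.sum_smul, hc']
  simp only [e]
  rw [Finset.sum_comm]
  simp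

end Change

theorem commute_of_inverse {R : Type*} [Monoid R] {v V X : R} (h1 : v * V = 1)
    (h2 : V * v = 1) (h : Commute V X) : Commute v X := by
  rw [commute_iff_eq]
  calc v * X = v * X * (V * v) := by rw [h2, mul_one]
    _ = v * (X * V) * v := by simp only [mul_assoc]
    _ = v * V * X * v := by rw [← h.eq]; simp only [mul_assoc]
    _ = X * v := by rw [h1, one_mul]

theorem RowIsometric.linear {H : Type*} [NormedAddCommGroup H] [InnerProductSpace ℂ H] {d : ℕ}
    {L : Fin d → H →L[ℂ] H} (hL : RowIsometric L) {A : Matrix (Fin d) (Fin d) ℂ}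
    (hA : A ∈ Matrix.unitaryGroup (Fin d) ℂ) : RowIsometric fun i => ∑ t, A i t • L t := by
  intro i j x y
  have h := congrFun (congrFun (Matrix.mem_unitaryGroup_iff.1 hA) j) i
  rw [Matrix.mul_apply, Matrix.one_apply] at h
  simp only [Matrix.star_apply] at h
  simp only [sum_apply, smul_apply, sum_inner, inner_sum, inner_smul_left, inner_smul_right,
    hL _ _ _ _, mul_ite, mul_zero, Finset.sum_ite_eq', Finset.mem_univ, if_true, ← mul_assoc,
    ← Finset.sum_mul]
  simp only [starRingEnd_apply, h, eq_comm (a := j)]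
  split_ifs <;> simp

theorem eq_sum_star_smul {R : Type*} [AddCommMonoid R] [Module ℂ R] {d : ℕ}
    {A : Matrix (Fin d) (Fin d) ℂ} (hA : A ∈ Matrix.unitaryGroup (Fin d) ℂ) (L : Fin d → R)
    (t : Fin d) : L t = ∑ i, star (A i t) • ∑ s, A i s • L s := by
  have h := fun s => congrFun (congrFun (Matrix.mem_unitaryGroup_iff'.1 hA) t) s
  simp only [Matrix.mul_apply, Matrix.one_apply, Matrix.star_apply] at h
  simp only [Finset.smul_sum, smul_smul]
  rw [Finset.sum_comm]
  simp only [← Finset.sum_smul, h]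
  simp

/-! ### The subspaces spanned by pure words -/

/-- The closed span of the words in the `e_i`. -/
def spanE (n m : ℕ) : Submodule ℂ (Fock n m) :=
  (Submodule.span ℂ (Set.range fun a : List (Fin n) => ket (a, []))).topologicalClosure

/-- The closed span of the words in the `f_j`. -/
def spanF (n m : ℕ) : Submodule ℂ (Fock n m) :=
  (Submodule.span ℂ (Set.range fun b : List (Fin m) => ket ([], b))).topologicalClosure

theorem closure_span_induction {H : Type*} [NormedAddCommGroup H] [NormedSpace ℂ H] {ι : Type*}
    {v : ι → H} {K : Submodule ℂ H} (hK : IsClosed (K : Set H)) (h : ∀ i, v i ∈ K) :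
    (Submodule.span ℂ (Set.range v)).topologicalClosure ≤ K :=
  Submodule.topologicalClosure_minimal _
    (Submodule.span_le.2 (by rintro _ ⟨i, rfl⟩; exact h i)) hK

theorem ket_mem_spanE (a : List (Fin n)) : ket (a, []) ∈ spanE n m :=
  Submodule.le_topologicalClosure _ (Submodule.subset_span ⟨a, rfl⟩)

theorem ket_mem_spanF (b : List (Fin m)) : ket ([], b) ∈ spanF n m :=
  Submodule.le_topologicalClosure _ (Submodule.subset_span ⟨b, rfl⟩)

theorem inner_eq_zero_of_mem_spanF {x : Fock n m} (hx : x ∈ spanF n m) (i : Fin n)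
    (y : Fock n m) : inner ℂ (Le i y) x = (0 : ℂ) := by
  have h := closure_span_induction (K := (innerSL ℂ (Le i y)).ker)
    (ContinuousLinearMap.isClosed_ker _) (v := fun b : List (Fin m) => ket ([], b))
    (fun b => by simp [inner_Le_ket_nil]) hx
  simpa using h

theorem inner_eq_zero_of_mem_spanE (u : Matrix.unitaryGroup (Fin n × Fin m) ℂ) {x : Fock n m}
    (hx : x ∈ spanE n m) (j : Fin m) (y : Fock n m) : inner ℂ (Lf u j y) x = (0 : ℂ) := by
  have h := closure_span_induction (K := (innerSL ℂ (Lf u j y)).ker)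
    (ContinuousLinearMap.isClosed_ker _) (v := fun a : List (Fin n) => ket (a, []))
    (fun b => by simp [inner_Lf_ket_nil]) hx
  simpa using h

/-- The norm closed unital algebra generated by the members of a tuple. -/
def closedAlg {H : Type*} [NormedAddCommGroup H] [NormedSpace ℂ H] {d : ℕ}
    (L : Fin d → H →L[ℂ] H) : Subalgebra ℂ (H →L[ℂ] H) :=
  (Algebra.adjoin ℂ (Set.range L)).topologicalClosure

theorem mem_closedAlg {H : Type*} [NormedAddCommGroup H] [NormedSpace ℂ H] {d : ℕ}
    (L : Fin d → H →L[ℂ] H) (i : Fin d) : L i ∈ closedAlg L :=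
  Subalgebra.le_topologicalClosure _ (Algebra.subset_adjoin ⟨i, rfl⟩)

theorem apply_mem_spanE {c : Fock n m →L[ℂ] Fock n m} (hc : c ∈ closedAlg Le) {x : Fock n m}
    (hx : x ∈ spanE n m) : c x ∈ spanE n m := by
  refine stabilizes_of_mem_closure _ (Submodule.isClosed_topologicalClosure _) _ ?_ hc hx
  rintro _ ⟨i, rfl⟩
  refine closure_span_induction (K := (spanE n m).comap (Le i).toLinearMap)
    ((Submodule.isClosed_topologicalClosure _).preimage (Le i).continuous) fun a => ?_
  simpa [Le_ket] using ket_mem_spanE (i :: a)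

theorem apply_mem_spanF {u : Matrix.unitaryGroup (Fin n × Fin m) ℂ}
    {c : Fock n m →L[ℂ] Fock n m} (hc : c ∈ closedAlg (Lf u)) {x : Fock n m}
    (hx : x ∈ spanF n m) : c x ∈ spanF n m := by
  refine stabilizes_of_mem_closure _ (Submodule.isClosed_topologicalClosure _) _ ?_ hc hx
  rintro _ ⟨i, rfl⟩
  refine closure_span_induction (K := (spanF n m).comap (Lf u i).toLinearMap)
    ((Submodule.isClosed_topologicalClosure _).preimage (Lf u i).continuous) fun a => ?_
  simpa [Lf_ket, fVec] using ket_mem_spanF (i :: a)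

variable {u : Matrix.unitaryGroup (Fin n × Fin m) ℂ}

/-! ### Existence of the automorphisms -/

theorem Le_mem_algA (u : Matrix.unitaryGroup (Fin n × Fin m) ℂ) (i : Fin n) : Le i ∈ algA u :=
  (genE u i).2

theorem Lf_mem_algA (u : Matrix.unitaryGroup (Fin n × Fin m) ℂ) (j : Fin m) : Lf u j ∈ algA u :=
  (genF u j).2

theorem automorphism_ext {Φ Ψ : algA u ≃ₐ[ℂ] algA u} (hΦ : Isometry Φ) (hΨ : Isometry Ψ)
    (he : ∀ i, Φ (genE u i) = Ψ (genE u i)) (hf : ∀ j, Φ (genF u j) = Ψ (genF u j)) : Φ = Ψ := by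
  have h := algHom_ext (φ := Φ.toAlgHom) (ψ := Ψ.toAlgHom)
    hΦ.continuous hΨ.continuous he hf
  ext a : 1
  exact DFunLike.congr_fun h a

theorem linear_mem {R : Type*} [Semiring R] [Algebra ℂ R] (C : Subalgebra ℂ R) {d : ℕ}
    {L : Fin d → R} (hL : ∀ i, L i ∈ C) (A : Matrix (Fin d) (Fin d) ℂ) (i : Fin d) :
    ∑ t, A i t • L t ∈ C :=
  C.sum_mem fun t _ => C.smul_mem (hL t) _

theorem mem_of_linear_mem {R : Type*} [Semiring R] [Algebra ℂ R] (C : Subalgebra ℂ R) {d : ℕ}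
    {L : Fin d → R} {A : Matrix (Fin d) (Fin d) ℂ} (hA : A ∈ Matrix.unitaryGroup (Fin d) ℂ)
    (h : ∀ i, ∑ t, A i t • L t ∈ C) (i : Fin d) : L i ∈ C := by
  rw [eq_sum_star_smul hA L i]
  exact C.sum_mem fun t _ => C.smul_mem (h t) _

theorem mem_closure_adjoin_left {R : Type*} [Ring R] [TopologicalSpace R] [IsTopologicalRing R]
    [Algebra ℂ R] {ι κ : Type*} (T : ι → R) (S : κ → R) (i : ι) :
    T i ∈ (Algebra.adjoin ℂ (Set.range T ∪ Set.range S)).topologicalClosure :=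
  Subalgebra.le_topologicalClosure _ (Algebra.subset_adjoin (Or.inl ⟨i, rfl⟩))

theorem mem_closure_adjoin_right {R : Type*} [Ring R] [TopologicalSpace R] [IsTopologicalRing R]
    [Algebra ℂ R] {ι κ : Type*} (T : ι → R) (S : κ → R) (j : κ) :
    S j ∈ (Algebra.adjoin ℂ (Set.range T ∪ Set.range S)).topologicalClosure :=
  Subalgebra.le_topologicalClosure _ (Algebra.subset_adjoin (Or.inr ⟨j, rfl⟩))

/-- The vacuum remains wandering for unitary combinations within each family, and unitarity gives
the shifts back from the combinations. -/
theorem exists_isPsi {A : Matrix (Fin n) (Fin n) ℂ} {B : Matrix (Fin m) (Fin m) ℂ}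
    (hA : A ∈ Matrix.unitaryGroup (Fin n) ℂ) (hB : B ∈ Matrix.unitaryGroup (Fin m) ℂ)
    (hAB : (A ⊗ₖ B) * u.1 = u.1 * (A ⊗ₖ B)) : ∃ Ψ, IsPsi u A B Ψ := by
  obtain ⟨Φ, h1, h2, h3⟩ := exists_automorphism (u := u) (ω := vac) (rowIsometric_Le.linear hA)
    ((rowIsometric_Lf u).linear hB) ((relation_shifts u).linear hAB) norm_vac
    (fun i x b => by
      have hmem := apply_mem_spanF
        (word_mem _ (linear_mem _ (mem_closedAlg (Lf u)) B) b) (ket_mem_spanF (n := n) [])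
      simp only [sum_apply, smul_apply, sum_inner, inner_smul_left, vac,
        inner_eq_zero_of_mem_spanF hmem, mul_zero, Finset.sum_const_zero])
    (fun j x => by
      simp [vac, inner_Lf_ket_nil])
    (linear_mem _ (Le_mem_algA u) A) (linear_mem _ (Lf_mem_algA u) B) rfl
    (mem_of_linear_mem _ hA (mem_closure_adjoin_left _ _))
    (mem_of_linear_mem _ hB (mem_closure_adjoin_right _ _))
    ⟨1, Subalgebra.one_mem _, rfl⟩
  refine ⟨Φ, h1, fun i => Subtype.ext ?_, fun j => Subtype.ext ?_⟩
  · rw [h2]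
    simp [genE]
  · rw [h3]
    simp [genF]

theorem exists_isPsiTilde {u : Matrix.unitaryGroup (Fin n × Fin n) ℂ}
    {A B : Matrix (Fin n) (Fin n) ℂ}
    (hA : A ∈ Matrix.unitaryGroup (Fin n) ℂ) (hB : B ∈ Matrix.unitaryGroup (Fin n) ℂ)
    (hAB : (A ⊗ₖ B) * tilde u = u.1 * (A ⊗ₖ B)) : ∃ Ψ, IsPsiTilde u A B Ψ := by
  obtain ⟨Φ, h1, h2, h3⟩ := exists_automorphism (u := u) (ω := vac)
    ((rowIsometric_Lf u).linear hA) (rowIsometric_Le.linear hB)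
    ((relation_shifts u).linear_swap hAB) norm_vac
    (fun i x b => by
      have hmem := apply_mem_spanE (m := n)
        (word_mem _ (linear_mem _ (mem_closedAlg Le) B) b) (ket_mem_spanE [])
      simp only [sum_apply, smul_apply, sum_inner, inner_smul_left, vac,
        inner_eq_zero_of_mem_spanE u hmem, mul_zero, Finset.sum_const_zero])
    (fun j x => by
      simp [vac, inner_Le_ket_nil])
    (linear_mem _ (Lf_mem_algA u) A) (linear_mem _ (Le_mem_algA u) B) rfl
    (mem_of_linear_mem _ hB (mem_closure_adjoin_right _ _))
    (mem_of_linear_mem _ hA (mem_closure_adjoin_left _ _))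
    ⟨1, Subalgebra.one_mem _, rfl⟩
  refine ⟨Φ, h1, fun i => Subtype.ext ?_, fun j => Subtype.ext ?_⟩
  · rw [h2]
    simp [genF]
  · rw [h3]
    simp [genE]

/-! ### The core equations and the existence of `Θ` -/

section Core

variable {z : EuclideanSpace ℂ (Fin n)} {w : EuclideanSpace ℂ (Fin m)}

/-- In coordinates, the vanishing of every `Cᵗ z` says that `u` fixes `z ⊗ f_l` for every `l`. -/
theorem core_left (h : (z, w) ∈ core u) (i : Fin n) (j l : Fin m) :
    ∑ k, u.1 (i, j) (k, l) * z k = if j = l then z i else 0 := by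
  have h' := congrFun ((h.2.2 i j).2) l
  simp only [Matrix.mulVec, dotProduct, Matrix.transpose_apply, coreMatrix, Matrix.sub_apply,
    Matrix.of_apply, Matrix.single_apply, sub_mul, Finset.sum_sub_distrib, Pi.zero_apply] at h'
  rw [sub_eq_zero.1 h']
  by_cases hjl : j = l <;> simp [hjl]

theorem core_right (h : (z, w) ∈ core u) (i : Fin n) (j : Fin m) (k : Fin n) :
    ∑ l, u.1 (i, j) (k, l) * w l = if i = k then w j else 0 := by
  have h' := congrFun ((h.2.2 i j).1) k
  simp only [Matrix.mulVec, dotProduct, coreMatrix, Matrix.sub_apply,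
    Matrix.of_apply, Matrix.single_apply, sub_mul, Finset.sum_sub_distrib, Pi.zero_apply] at h'
  rw [sub_eq_zero.1 h']
  by_cases hjl : i = k <;> simp [hjl]

theorem mem_core_of_sums (hz : ‖z‖ ≤ 1) (hw : ‖w‖ ≤ 1)
    (h1 : ∀ i j l, ∑ k, u.1 (i, j) (k, l) * z k = if j = l then z i else 0)
    (h2 : ∀ i j k, ∑ l, u.1 (i, j) (k, l) * w l = if i = k then w j else 0) :
    (z, w) ∈ core u := by
  refine ⟨hz, hw, fun i j => ⟨?_, ?_⟩⟩
  · ext k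
    simp only [Matrix.mulVec, dotProduct, coreMatrix, Matrix.sub_apply,
      Matrix.of_apply, Matrix.single_apply, sub_mul, Finset.sum_sub_distrib, Pi.zero_apply, h2]
    by_cases hjl : i = k <;> simp [hjl]
  · ext l
    simp only [Matrix.mulVec, dotProduct, Matrix.transpose_apply, coreMatrix, Matrix.sub_apply,
      Matrix.of_apply, Matrix.single_apply, sub_mul, Finset.sum_sub_distrib, Pi.zero_apply, h1]
    by_cases hjl : j = l <;> simp [hjl]

theorem star_eta {d : ℕ} (z : EuclideanSpace ℂ (Fin d)) (i : Fin d) :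
    star (eta z i) = xZero z * z i := by
  simp [eta]

theorem core_left_eta (h : (z, w) ∈ core u) (i : Fin n) (j l : Fin m) :
    ∑ k, u.1 (i, j) (k, l) * star (eta z k) = if j = l then star (eta z i) else 0 := by
  have hx := congrArg (fun x => (xZero z : ℂ) * x) (core_left h i j l)
  simp only [Finset.mul_sum, mul_ite, mul_zero, mul_left_comm (xZero z : ℂ)] at hx
  simpa only [star_eta] using hx

theorem core_right_eta (h : (z, w) ∈ core u) (i : Fin n) (j : Fin m) (k : Fin n) :
    ∑ l, u.1 (i, j) (k, l) * star (eta w l) = if i = k then star (eta w j) else 0 := by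
  have hx := congrArg (fun x => (xZero w : ℂ) * x) (core_right h i j k)
  simp only [Finset.mul_sum, mul_ite, mul_zero, mul_left_comm (xZero w : ℂ)] at hx
  simpa only [star_eta] using hx

/-- If `u` fixes the range of a Hermitian matrix `P`, it commutes with `P`. -/
theorem commute_one_add_smul {ι : Type*} [Fintype ι] [DecidableEq ι] {U P : Matrix ι ι ℂ}
    (hU : U ∈ Matrix.unitaryGroup ι ℂ) (hP : star P = P) (h : U * P = P) (c : ℂ) :
    Commute (1 + c • P) U := by
  have h' : star U * P = P := by
    conv_lhs => rw [← h, ← mul_assoc, Matrix.mem_unitaryGroup_iff'.1 hU, one_mul]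
  have h2 : P * U = P := by
    have := congrArg star h'
    rwa [star_mul, star_star, hP] at this
  refine (Commute.one_left _).add_left (Commute.smul_left ?_ c)
  rw [commute_iff_eq, h, h2]

/-- Each factor is the identity plus a multiple of a Hermitian matrix with range in `z ⊗ F` or in `E
⊗ w`, and `u` fixes both spaces. The transposes appear because `mobius` sums over the row index of
`xOne`. -/
theorem xOne_transpose_kronecker (h : (z, w) ∈ core u) :
    ((xOne z).transpose ⊗ₖ (xOne w).transpose) * u.1 =
      u.1 * ((xOne z).transpose ⊗ₖ (xOne w).transpose) := by
  let P : Matrix (Fin n × Fin m) (Fin n × Fin m) ℂ :=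
    (Matrix.vecMulVec (star (eta z)) (eta z)) ⊗ₖ 1
  let Q : Matrix (Fin n × Fin m) (Fin n × Fin m) ℂ :=
    1 ⊗ₖ (Matrix.vecMulVec (star (eta w)) (eta w))
  have hP : star P = P := by
    ext p q
    by_cases hpq : p.2 = q.2 <;>
      simp [P, Matrix.star_apply, Matrix.kroneckerMap_apply, Matrix.vecMulVec_apply,
        Matrix.one_apply, mul_comm, hpq, eq_comm (a := q.2)]
  have hQ : star Q = Q := by
    ext p q
    by_cases hpq : p.1 = q.1 <;>
      simp [Q, Matrix.star_apply, Matrix.kroneckerMap_apply, Matrix.vecMulVec_apply,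
        Matrix.one_apply, mul_comm, hpq, eq_comm (a := q.1)]
  have hUP : u.1 * P = P := by
    ext ⟨i, j⟩ ⟨k, l⟩
    have := core_left_eta h i j l
    simp only [P, Matrix.mul_apply, Fintype.sum_prod_type, Matrix.kroneckerMap_apply,
      Matrix.vecMulVec_apply, Matrix.one_apply, Pi.star_apply, mul_ite, mul_one, mul_zero,
      Finset.sum_ite_eq', Finset.mem_univ, if_true, ← mul_assoc, ← Finset.sum_mul, this]
    split_ifs <;> simp
  have hUQ : u.1 * Q = Q := by
    ext ⟨i, j⟩ ⟨k, l⟩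
    have := core_right_eta h i j k
    simp only [Q, Matrix.mul_apply, Fintype.sum_prod_type_right, Matrix.kroneckerMap_apply,
      Matrix.vecMulVec_apply, Matrix.one_apply, Pi.star_apply, ite_mul, one_mul, zero_mul, mul_ite,
      mul_zero,
      Finset.sum_ite_eq', Finset.mem_univ, if_true, ← mul_assoc, ← Finset.sum_mul, this]
  have e1 : (xOne z).transpose ⊗ₖ (1 : Matrix (Fin m) (Fin m) ℂ) =
      1 + ((xZero z + 1 : ℝ) : ℂ)⁻¹ • P := by
    simp [xOne, P, Matrix.transpose_add, Matrix.transpose_smul, Matrix.add_kronecker,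
      Matrix.smul_kronecker, Matrix.transpose_vecMulVec]
  have e2 : (1 : Matrix (Fin n) (Fin n) ℂ) ⊗ₖ (xOne w).transpose =
      1 + ((xZero w + 1 : ℝ) : ℂ)⁻¹ • Q := by
    simp [xOne, Q, Matrix.transpose_add, Matrix.transpose_smul, Matrix.kronecker_add,
      Matrix.kronecker_smul, Matrix.transpose_vecMulVec]
  have e3 : (xOne z).transpose ⊗ₖ (xOne w).transpose =
      ((xOne z).transpose ⊗ₖ (1 : Matrix (Fin m) (Fin m) ℂ)) *
        ((1 : Matrix (Fin n) (Fin n) ℂ) ⊗ₖ (xOne w).transpose) := by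
    rw [← Matrix.mul_kronecker_mul, mul_one, one_mul]
  rw [e3, e1, e2]
  exact (commute_one_add_smul u.2 hP hUP _).mul_left (commute_one_add_smul u.2 hQ hUQ _)

/-- The transformed tuples arise from the shifts by a linear change, a translation and
multiplication by resolvents, and the core equations let each step preserve the relations. The
wandering vector is the normalised image of the vacuum under both resolvents. -/
theorem exists_isTheta (h : (z, w) ∈ openCore u) : ∃ Θ, IsTheta u z w Θ := by
  obtain ⟨hcore, hz, hw⟩ := h
  obtain ⟨v, hvC, hv⟩ := exists_isResolvent (rowIsometric_Le (m := m)) hz (closedAlg Le)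
    (Subalgebra.isClosed_topologicalClosure _) (mem_closedAlg _)
  obtain ⟨v', hvC', hv'⟩ := exists_isResolvent (rowIsometric_Lf u) hw (closedAlg (Lf u))
    (Subalgebra.isClosed_topologicalClosure _) (mem_closedAlg _)
  have hrel := relation_shifts u
  have hVf : ∀ j, Commute v (Lf u j) := fun j => commute_of_inverse hv.left hv.right
    (((Commute.one_left _).smul_left _).sub_left (hrel.commute_left (core_left_eta hcore) j))
  have hVe : ∀ i, Commute v' (Le i) := fun i => commute_of_inverse hv'.left hv'.right
    (((Commute.one_left _).smul_left _).sub_left (hrel.commute_right (core_right_eta hcore) i))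
  have hvv : Commute v v' := by
    refine (commute_of_inverse hv'.left hv'.right ?_).symm
    refine ((Commute.one_left _).smul_left _).sub_left (Commute.sum_left _ _ _ fun t _ => ?_)
    exact ((hVf t).symm).smul_left _
  have hrelTS : Relation u (mobius Le z) (mobius (Lf u) w) := by
    have h1 := ((hrel.linear (xOne_transpose_kronecker hcore)).affine (core_left_eta hcore)
      (core_right_eta hcore)).mul_left hvv
      (fun j => (Commute.sum_right _ _ _ fun t _ => (hVf t).smul_right _).sub_right
        ((Commute.one_right _).smul_right _))
      (fun j => (Commute.sum_right _ _ _ fun t _ => (hVe t).smul_right _).sub_right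
        ((Commute.one_right _).smul_right _))
    have e1 : mobius Le z = _ := funext hv.mobius_eq
    have e2 : mobius (Lf u) w = _ := funext hv'.mobius_eq
    rw [e1, e2]
    exact h1
  have hSC : ∀ j, mobius (Lf u) w j ∈ closedAlg (Lf u) :=
    hv'.mobius_mem hvC' (mem_closedAlg _)
  have hvS : ∀ j, Commute v (mobius (Lf u) w j) := fun j => by
    rw [hv'.mobius_eq]
    exact hvv.mul_right ((Commute.sum_right _ _ _ fun t _ => (hVf t).smul_right _).sub_right
        ((Commute.one_right _).smul_right _))
  have hvword : ∀ b, Commute v (word (mobius (Lf u) w) b) := by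
    intro b
    induction b with
    | nil => exact Commute.one_right _
    | cons j b ih => rw [word_cons]; exact (hvS j).mul_right ih
  have hT := hv.rowIsometric rowIsometric_Le hz
  have hS := hv'.rowIsometric (rowIsometric_Lf u) hw
  set V : Fock n m →L[ℂ] Fock n m := (xZero z : ℂ) • 1 - ∑ t, eta z t • Le t with hV
  set V' : Fock n m →L[ℂ] Fock n m := (xZero w : ℂ) • 1 - ∑ t, eta w t • Lf u t with hV'
  have hVω : (V' * V) (v (v' vac)) = vac := by
    have : V' * V * (v * v') = 1 := by
      rw [mul_assoc, ← mul_assoc V, hv.right, one_mul, hv'.right]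
    exact DFunLike.congr_fun this vac
  have hne : v (v' vac) ≠ 0 := by
    intro h0
    rw [h0, map_zero] at hVω
    have := norm_vac (n := n) (m := m)
    rw [← hVω, norm_zero] at this
    exact zero_ne_one this
  set c : ℂ := (‖v (v' vac)‖ : ℂ)⁻¹ with hc
  have hc0 : c ≠ 0 := by simpa [hc] using hne
  have hle : ∀ {d : ℕ} {L : Fin d → Fock n m →L[ℂ] Fock n m}, (∀ i, L i ∈ algA u) →
      closedAlg L ≤ algA u := fun hL =>
    Subalgebra.topologicalClosure_minimal (Algebra.adjoin_le (by rintro _ ⟨i, rfl⟩; exact hL i))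
      (isClosed_algA u)
  -- The transformed tuple generates the original one: `v = x₀ + ∑ η_t T_t` is inverted inside `C`
  -- by a Neumann series, and that inverse is `x₀ - L_η`.
  have hinv : ∀ {d : ℕ} {L : Fin d → Fock n m →L[ℂ] Fock n m} {y : EuclideanSpace ℂ (Fin d)}
      {v : Fock n m →L[ℂ] Fock n m} {C : Subalgebra ℂ (Fock n m →L[ℂ] Fock n m)},
      IsClosed (C : Set (Fock n m →L[ℂ] Fock n m)) → RowIsometric L → ‖y‖ < 1 →
      IsResolvent L y v → (∀ i, mobius L y i ∈ C) →
      ((xZero y : ℂ) • 1 - ∑ t, eta y t • L t) ∈ C ∧ ∀ i, L i ∈ C := by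
    intro d L y v C hC hL hy hv hmem
    have hlt := norm_sum_eta_lt (hv.rowIsometric hL hy) hy
    rw [← norm_neg] at hlt
    obtain ⟨a, ha, h1, h2⟩ := exists_inverse_mem C hC (C.neg_mem
      (C.sum_mem fun t _ => C.smul_mem (hmem t) (eta y t))) hlt
    rw [sub_neg_eq_add, ← hv.eq_add hy] at h1 h2
    have e : a = (xZero y : ℂ) • 1 - ∑ t, eta y t • L t := left_inv_eq_right_inv h1 hv.left
    rw [e] at ha
    refine ⟨ha, fun i => ?_⟩
    rw [hv.tuple_eq hy i]
    exact C.mul_mem ha (C.add_mem (C.sum_mem fun t _ => C.smul_mem (hmem t) _)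
      (C.smul_mem C.one_mem _))
  have hCcl := Subalgebra.isClosed_topologicalClosure
    (Algebra.adjoin ℂ (Set.range (mobius (Le (m := m)) z) ∪ Set.range (mobius (Lf u) w)))
  have hE := hinv hCcl rowIsometric_Le hz hv (mem_closure_adjoin_left _ _)
  have hF := hinv hCcl (rowIsometric_Lf u) hw hv' (mem_closure_adjoin_right _ _)
  obtain ⟨Φ, h1, h2, h3⟩ := exists_automorphism (u := u) (ω := c • v (v' vac)) hT hS hrelTS
    (by rw [norm_smul, hc, norm_inv, Complex.norm_real, norm_norm,
      inv_mul_cancel₀ (norm_ne_zero_iff.2 hne)])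
    (fun i x b => by
      -- As `v` commutes with the words in `S`, the vector is `v` applied to an element of `spanF`,
      -- which is orthogonal to the ranges of the `Le i`.
      have e : word (mobius (Lf u) w) b (v (v' vac)) = v (word (mobius (Lf u) w) b (v' vac)) :=
        (DFunLike.congr_fun (hvword b).eq (v' vac)).symm
      rw [map_smul, inner_smul_right, e, hv.inner_mobius rowIsometric_Le hz, mul_zero]
      exact inner_eq_zero_of_mem_spanF
        (apply_mem_spanF (word_mem _ hSC b) (apply_mem_spanF hvC' (ket_mem_spanF []))))
    (fun j x => by
      have e : v (v' vac) = v' (v vac) := DFunLike.congr_fun hvv.eq vac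
      rw [inner_smul_right, e, hv'.inner_mobius (rowIsometric_Lf u) hw, mul_zero]
      exact inner_eq_zero_of_mem_spanE u (apply_mem_spanE hvC (ket_mem_spanE [])))
    (hv.mobius_mem (hle (Le_mem_algA u) hvC) (Le_mem_algA u))
    (hv'.mobius_mem (hle (Lf_mem_algA u) hvC') (Lf_mem_algA u)) rfl hE.2 hF.2
    ⟨c⁻¹ • (V' * V), Subalgebra.smul_mem _ (Subalgebra.mul_mem _ hF.1 hE.1) _, by
      rw [map_smul, smul_apply, hVω, smul_smul, mul_inv_cancel₀ hc0, one_smul]⟩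
  exact ⟨Φ, h1, h2, h3⟩

end Core

/-! ### Existence and uniqueness combined -/

theorem existsUnique_isPsi {A : Matrix (Fin n) (Fin n) ℂ} {B : Matrix (Fin m) (Fin m) ℂ}
    (hA : A ∈ Matrix.unitaryGroup (Fin n) ℂ) (hB : B ∈ Matrix.unitaryGroup (Fin m) ℂ)
    (hAB : (A ⊗ₖ B) * u.1 = u.1 * (A ⊗ₖ B)) : ∃! Ψ, IsPsi u A B Ψ :=
  existsUnique_of_exists_of_unique (exists_isPsi hA hB hAB) fun _ _ h h' =>
    automorphism_ext h.1 h'.1 (fun i => (h.2.1 i).trans (h'.2.1 i).symm)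
      (fun j => (h.2.2 j).trans (h'.2.2 j).symm)

theorem existsUnique_isPsiTilde {u : Matrix.unitaryGroup (Fin n × Fin n) ℂ}
    {A B : Matrix (Fin n) (Fin n) ℂ}
    (hA : A ∈ Matrix.unitaryGroup (Fin n) ℂ) (hB : B ∈ Matrix.unitaryGroup (Fin n) ℂ)
    (hAB : (A ⊗ₖ B) * tilde u = u.1 * (A ⊗ₖ B)) : ∃! Ψ, IsPsiTilde u A B Ψ :=
  existsUnique_of_exists_of_unique (exists_isPsiTilde hA hB hAB) fun _ _ h h' =>
    automorphism_ext h.1 h'.1 (fun i => (h.2.1 i).trans (h'.2.1 i).symm)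
      (fun j => (h.2.2 j).trans (h'.2.2 j).symm)

theorem existsUnique_isTheta {z : EuclideanSpace ℂ (Fin n)} {w : EuclideanSpace ℂ (Fin m)}
    (h : (z, w) ∈ openCore u) : ∃! Θ, IsTheta u z w Θ :=
  existsUnique_of_exists_of_unique (exists_isTheta h) fun _ _ h h' =>
    automorphism_ext h.1 h'.1 (fun i => Subtype.ext ((h.2.1 i).trans (h'.2.1 i).symm))
      (fun j => Subtype.ext ((h.2.2 j).trans (h'.2.2 j).symm))

/-! ### Elements of the algebra are determined by their value at the vacuum -/

/-- The total length of a pair of words. -/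
def len (p : List (Fin n) × List (Fin m)) : ℕ := p.1.length + p.2.length

theorem inner_ket_nil_Le (i : Fin n) (x : Fock n m) (b : List (Fin m)) :
    inner ℂ (ket ([], b)) (Le i x) = (0 : ℂ) := by
  rw [← inner_conj_symm, inner_Le_ket_nil, map_zero]

theorem inner_ket_cons_Le (k : Fin n) (a : List (Fin n)) (b : List (Fin m)) (i : Fin n)
    (x : Fock n m) :
    inner ℂ (ket (k :: a, b)) (Le i x) = if k = i then (inner ℂ (ket (a, b)) x : ℂ) else 0 := by
  rw [← Le_ket k (a, b)]
  exact rowIsometric_Le k i _ x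

/-- Moving `f_l` through a word preserves the total length. -/
theorem inner_ket_fVec (u : Matrix.unitaryGroup (Fin n × Fin m) ℂ) (b : List (Fin m)) :
    ∀ (a : List (Fin n)) (q : List (Fin n) × List (Fin m)) (l : Fin m),
      len q ≠ len (a, b) + 1 → inner ℂ (ket q) (fVec u a b l) = (0 : ℂ)
  | [], q, l, h => by
    rw [fVec, inner_ket, if_neg]
    rintro rfl
    exact h (by simp [len])
  | k :: a, q, l, h => by
    have hLe : ∀ i (x : Fock n m), eIso i x = Le i x := fun _ _ => rfl
    simp only [fVec, inner_sum, inner_smul_right, hLe]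
    refine Finset.sum_eq_zero fun i _ => Finset.sum_eq_zero fun j _ => ?_
    obtain ⟨_ | ⟨k', a'⟩, b'⟩ := q
    · rw [inner_ket_nil_Le, mul_zero]
    · rw [inner_ket_cons_Le, inner_ket_fVec u b a (a', b') j, ite_self, mul_zero]
      simp only [len, List.length_cons] at h ⊢
      omega

/-- The coordinates of `x` at the basis vectors of total length less than `d` vanish. -/
def VanishesBelow (d : ℕ) (x : Fock n m) : Prop := ∀ p, len p < d → x p = 0

theorem VanishesBelow.Le {d : ℕ} {x : Fock n m} (hx : VanishesBelow d x) (i : Fin n) :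
    VanishesBelow (d + 1) (Le i x) := by
  rintro ⟨_ | ⟨k, a⟩, b⟩ h
  · rw [← inner_ket_left, inner_ket_nil_Le]
  · rw [← inner_ket_left, inner_ket_cons_Le, inner_ket_left, hx, ite_self]
    simp only [len, List.length_cons] at h ⊢
    omega

theorem VanishesBelow.Lf {d : ℕ} {x : Fock n m} (hx : VanishesBelow d x) (l : Fin m) :
    VanishesBelow (d + 1) (Lf u l x) := by
  intro q hq
  rw [← inner_ket_left]
  refine ((hasSum_ket x).mapL ((innerSL ℂ (ket q)).comp (UnitaryRelation.Lf u l))).unique ?_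
  convert hasSum_zero using 2 with p
  by_cases hp : len p < d
  · simp [hx p hp]
  · have := inner_ket_fVec u p.2 p.1 q l (by simp only [Prod.mk.eta]; omega)
    simp [Lf_ket, this]

theorem vanishesBelow_monomial (u : Matrix.unitaryGroup (Fin n × Fin m) ℂ)
    (p : List (Fin n) × List (Fin m)) (x : Fock n m) :
    VanishesBelow (len p) (monomial u p x) := by
  obtain ⟨a, b⟩ := p
  induction a with
  | nil =>
    induction b with
    | nil => exact fun _ h => absurd h (Nat.not_lt_zero _)
    | cons j b ih =>
      have := ih.Lf (u := u) j
      simpa [monomial, len, mul_apply_eq_comp, add_assoc] using this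
  | cons i a ih =>
    have := ih.Le i
    simpa [monomial, len, mul_apply_eq_comp, add_right_comm] using this

/-- The swapped relation moves every `Lf` to the right of every `Le`, so the span of ordered
monomials is closed under left multiplication by the shifts. -/
theorem mem_span_monomial {a : Fock n m →L[ℂ] Fock n m}
    (ha : a ∈ Algebra.adjoin ℂ (Set.range Le ∪ Set.range (Lf u))) :
    a ∈ Submodule.span ℂ (Set.range (monomial u)) := by
  set K := Submodule.span ℂ (Set.range (monomial u)) with hK
  have hmem : ∀ p, monomial u p ∈ K := fun p => Submodule.subset_span ⟨p, rfl⟩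
  have hLe : ∀ i, ∀ x ∈ K, Le i * x ∈ K := by
    intro i x hx
    refine (Submodule.span_le (p := K.comap (LinearMap.mulLeft ℂ (Le i)))).2 ?_ hx
    rintro _ ⟨p, rfl⟩
    have : Le i * monomial u p = monomial u (i :: p.1, p.2) := by simp [monomial, mul_assoc]
    simpa [this] using hmem _
  have hLf : ∀ l, ∀ x ∈ K, Lf u l * x ∈ K := by
    intro l x hx
    refine (Submodule.span_le (p := K.comap (LinearMap.mulLeft ℂ (Lf u l)))).2 ?_ hx
    rintro _ ⟨⟨a, b⟩, rfl⟩
    change Lf u l * monomial u (a, b) ∈ K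
    induction a generalizing l with
    | nil =>
      have : Lf u l * monomial u ([], b) = monomial u ([], l :: b) := by simp [monomial]
      rw [this]
      exact hmem _
    | cons k a ih =>
      have : Lf u l * monomial u (k :: a, b) = Lf u l * Le k * monomial u (a, b) := by
        simp [monomial, mul_assoc]
      rw [this, (relation_shifts u).swap, Finset.sum_mul]
      refine K.sum_mem fun i _ => ?_
      rw [Finset.sum_mul]
      refine K.sum_mem fun j _ => ?_
      rw [smul_mul_assoc, mul_assoc]
      exact K.smul_mem _ (hLe i _ (ih j))
  let St : Subalgebra ℂ (Fock n m →L[ℂ] Fock n m) :=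
    { carrier := {a | ∀ x ∈ K, a * x ∈ K}
      mul_mem' := fun {a b} ha hb x hx => by rw [mul_assoc]; exact ha _ (hb x hx)
      add_mem' := fun {a b} ha hb x hx => by rw [add_mul]; exact K.add_mem (ha x hx) (hb x hx)
      algebraMap_mem' := fun r x hx => by
        simpa [Algebra.algebraMap_eq_smul_one] using K.smul_mem r hx }
  have h : Algebra.adjoin ℂ (Set.range Le ∪ Set.range (Lf u)) ≤ St := by
    refine Algebra.adjoin_le ?_
    rintro _ (⟨i, rfl⟩ | ⟨j, rfl⟩)
    exacts [hLe i, hLf j]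
  have h1 : (1 : Fock n m →L[ℂ] Fock n m) ∈ K := by
    simpa [monomial] using hmem ([], [])
  simpa using h ha 1 h1

theorem finite_len_le (d : ℕ) : {p : List (Fin n) × List (Fin m) | len p ≤ d}.Finite := by
  refine ((List.finite_length_le (Fin n) d).prod (List.finite_length_le (Fin m) d)).subset ?_
  rintro ⟨a, b⟩ h
  simp only [len, Set.mem_ofPred_eq] at h
  exact ⟨by simp; omega, by simp; omega⟩

/-- A noncommutative Taylor expansion, with coefficients read off at the vacuum. Monomials longer
than `q` do not reach the coordinate `q`, so the sum is finite and the identity passes from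
polynomials to norm limits. -/
theorem apply_eq_sum_monomial {a : Fock n m →L[ℂ] Fock n m} (ha : a ∈ algA u)
    (q : List (Fin n) × List (Fin m)) (y : Fock n m) :
    a y q = ∑ p ∈ (finite_len_le (len q)).toFinset, a vac p * monomial u p y q := by
  let ev : Fock n m → (List (Fin n) × List (Fin m)) → (Fock n m →L[ℂ] Fock n m) →L[ℂ] ℂ :=
    fun y q => (innerSL ℂ (ket q)).comp (ContinuousLinearMap.apply ℂ (Fock n m) y)
  have hev : ∀ y q a, ev y q a = a y q := fun y q a => by
    simp [ev, inner_ket_left]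
  -- For fixed `y` and `q` the difference of the two sides is a continuous functional of the
  -- operator, so it suffices that it kills the monomials.
  let D : (Fock n m →L[ℂ] Fock n m) →L[ℂ] ℂ :=
    ev y q - ∑ p ∈ (finite_len_le (len q)).toFinset, monomial u p y q • ev vac p
  suffices h : D a = 0 by
    rw [← sub_eq_zero]
    simpa [D, hev, sum_apply, mul_comm] using h
  have hcl : IsClosed (D.ker : Set (Fock n m →L[ℂ] Fock n m)) := D.isClosed_ker
  have hsub : (Algebra.adjoin ℂ (Set.range Le ∪ Set.range (Lf u)) :
      Set (Fock n m →L[ℂ] Fock n m)) ⊆ D.ker := by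
    intro b hb
    refine Submodule.span_le.2 ?_ (mem_span_monomial hb)
    rintro _ ⟨t, rfl⟩
    have hvac : ∀ p, monomial u t vac p = if p = t then 1 else 0 := fun p => by
      rw [monomial_vac, ← inner_ket_left, inner_ket]
    suffices h : monomial u t y q = if len t ≤ len q then monomial u t y q else 0 by
      simpa [D, hev, sum_apply, hvac, sub_eq_zero] using h
    split_ifs with h
    · rfl
    · exact vanishesBelow_monomial u t y q (not_le.1 h)
  exact closure_minimal hsub hcl ha

/-- The vacuum is a separating vector. -/
theorem ext_vac {a b : algA u} (h : a.1 vac = b.1 vac) : a = b := by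
  refine Subtype.ext (ContinuousLinearMap.ext fun y => lp.ext (funext fun q => ?_))
  rw [apply_eq_sum_monomial a.2, apply_eq_sum_monomial b.2, h]

/-! ### Characters and point derivations -/

/-- The generators `L_{e_i}` and `L_{f_j}` as one family. -/
def gen (u : Matrix.unitaryGroup (Fin n × Fin m) ℂ) : Fin n ⊕ Fin m → algA u :=
  Sum.elim (genE u) (genF u)

/-- The basis vectors `e_i` and `f_j` as one family. -/
def ketOne : Fin n ⊕ Fin m → Fock n m :=
  Sum.elim (fun i => ket ([i], [])) (fun j => ket ([], [j]))

theorem gen_vac (p : Fin n ⊕ Fin m) : (gen u p).1 vac = ketOne p := by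
  cases p with
  | inl i => exact Le_ket i ([], [])
  | inr j => exact Lf_ket u j ([], [])

theorem inner_vac_vac : inner ℂ (vac : Fock n m) vac = (1 : ℂ) := by
  rw [vac, inner_ket, if_pos rfl]

theorem inner_ketOne (p q : Fin n ⊕ Fin m) :
    inner ℂ (ketOne p) (ketOne q) = if p = q then (1 : ℂ) else 0 := by
  rcases p with i | j <;> rcases q with k | l <;> simp [ketOne, inner_ket]

theorem orthonormal_ketOne : Orthonormal ℂ (ketOne : Fin n ⊕ Fin m → Fock n m) := by
  rw [orthonormal_iff_ite]
  exact inner_ketOne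

theorem inner_vac_gen (p : Fin n ⊕ Fin m) (x : Fock n m) :
    inner ℂ vac ((gen u p).1 x) = (0 : ℂ) := by
  rw [← inner_conj_symm]
  rcases p with i | j
  · rw [show inner ℂ ((gen u (Sum.inl i)).1 x) vac = (0 : ℂ) from inner_Le_ket_nil i x [], map_zero]
  · rw [show inner ℂ ((gen u (Sum.inr j)).1 x) vac = (0 : ℂ) from inner_Lf_ket_nil u j x [],
      map_zero]

theorem gen_induction (C : Subalgebra ℂ (algA u)) (hC : IsClosed (C : Set (algA u)))
    (h : ∀ p, gen u p ∈ C) (a : algA u) : a ∈ C := by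
  rw [eq_top_of_isClosed C hC (fun i => h (Sum.inl i)) (fun j => h (Sum.inr j))]
  exact Algebra.mem_top

theorem continuous_inner_apply (ω x : Fock n m) :
    Continuous fun a : algA u => (inner ℂ ω (a.1 x) : ℂ) :=
  ((innerSL ℂ ω).comp (ContinuousLinearMap.apply ℂ (Fock n m) x)).continuous.comp
    continuous_subtype_val

/-- The hypothesis makes `ω` a joint eigenvector of the adjoints of the generators. The elements `a`
whose adjoint has `ω` as an eigenvector form a closed subalgebra, on which the eigenvalue is
multiplicative. -/
theorem exists_character {ω : Fock n m} (hω : ω ≠ 0) {c : Fin n ⊕ Fin m → ℂ}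
    (h : ∀ p x, inner ℂ ω ((gen u p).1 x) = c p * (inner ℂ ω x : ℂ)) :
    ∃ χ : algA u →ₐ[ℂ] ℂ, (∀ a x, inner ℂ ω (a.1 x) = χ a * (inner ℂ ω x : ℂ)) ∧
      ∀ p, χ (gen u p) = c p := by
  have hN : (inner ℂ ω ω : ℂ) ≠ 0 := inner_self_ne_zero.2 hω
  let φ : algA u → ℂ := fun a => inner ℂ ω (a.1 ω) / inner ℂ ω ω
  have hmul : ∀ a b : algA u, (∀ x, inner ℂ ω (a.1 x) = φ a * (inner ℂ ω x : ℂ)) →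
      (∀ x, inner ℂ ω (b.1 x) = φ b * (inner ℂ ω x : ℂ)) → φ (a * b) = φ a * φ b := by
    intro a b ha hb
    change inner ℂ ω (a.1 (b.1 ω)) / inner ℂ ω ω = _
    rw [ha, hb]
    field_simp
  have halg : ∀ r : ℂ, φ (algebraMap ℂ _ r) = r := by
    intro r
    change inner ℂ ω ((algebraMap ℂ (Fock n m →L[ℂ] Fock n m) r) ω) / inner ℂ ω ω = r
    rw [Algebra.algebraMap_eq_smul_one, smul_apply, one_apply_eq_self, inner_smul_right]
    field_simp
  have hadd : ∀ a b : algA u, φ (a + b) = φ a + φ b := by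
    intro a b
    change inner ℂ ω (a.1 ω + b.1 ω) / inner ℂ ω ω = _
    rw [inner_add_right, add_div]
  let C : Subalgebra ℂ (algA u) :=
    { carrier := {a | ∀ x, inner ℂ ω (a.1 x) = φ a * (inner ℂ ω x : ℂ)}
      mul_mem' := fun {a b} ha hb x => by
        rw [hmul a b ha hb]
        change inner ℂ ω (a.1 (b.1 x)) = _
        rw [ha, hb, mul_assoc]
      add_mem' := fun {a b} ha hb x => by
        rw [hadd]
        change inner ℂ ω (a.1 x + b.1 x) = _
        rw [inner_add_right, ha, hb, add_mul]
      algebraMap_mem' := fun r x => by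
        rw [halg]
        change inner ℂ ω ((algebraMap ℂ (Fock n m →L[ℂ] Fock n m) r) x) = _
        rw [Algebra.algebraMap_eq_smul_one, smul_apply, one_apply_eq_self, inner_smul_right] }
  have hφgen : ∀ p, φ (gen u p) = c p := by
    intro p
    change inner ℂ ω ((gen u p).1 ω) / inner ℂ ω ω = _
    rw [h]
    field_simp
  have hC : ∀ a : algA u, ∀ x, inner ℂ ω (a.1 x) = φ a * (inner ℂ ω x : ℂ) := by
    refine gen_induction C ?_ fun p x => ?_
    · have : (C : Set (algA u)) =
          ⋂ x, {a : algA u | inner ℂ ω (a.1 x) = φ a * (inner ℂ ω x : ℂ)} := by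
        ext a
        simp only [Set.mem_iInter, Set.mem_ofPred_eq]
        rfl
      rw [this]
      exact isClosed_iInter fun x => isClosed_eq (continuous_inner_apply ω x)
        (((continuous_inner_apply ω ω).div_const _).mul_const _)
    · rw [hφgen, h]
  exact ⟨
    { toFun := φ
      map_one' := by simpa using halg 1
      map_zero' := by simpa using halg 0
      map_mul' := fun a b => hmul a b (hC a) (hC b)
      map_add' := hadd
      commutes' := halg }, hC, hφgen⟩

theorem vac_ne_zero : (vac : Fock n m) ≠ 0 := by
  rw [← norm_ne_zero_iff, norm_vac]
  exact one_ne_zero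

theorem exists_vacChar (u : Matrix.unitaryGroup (Fin n × Fin m) ℂ) :
    ∃ χ : algA u →ₐ[ℂ] ℂ, (∀ a x, inner ℂ vac (a.1 x) = χ a * (inner ℂ vac x : ℂ)) ∧
      ∀ p, χ (gen u p) = 0 :=
  exists_character (c := 0) vac_ne_zero fun p x => by rw [inner_vac_gen]; simp

/-- The vacuum character `a ↦ ⟨Ω, a Ω⟩`. -/
def vacChar (u : Matrix.unitaryGroup (Fin n × Fin m) ℂ) : algA u →ₐ[ℂ] ℂ :=
  (exists_vacChar u).choose

theorem inner_vac_apply (a : algA u) (x : Fock n m) :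
    inner ℂ vac (a.1 x) = vacChar u a * (inner ℂ vac x : ℂ) :=
  (exists_vacChar u).choose_spec.1 a x

theorem vacChar_gen (p : Fin n ⊕ Fin m) : vacChar u (gen u p) = 0 :=
  (exists_vacChar u).choose_spec.2 p

theorem vacChar_apply (a : algA u) : vacChar u a = inner ℂ vac (a.1 vac) := by
  rw [inner_vac_apply, inner_vac_vac, mul_one]

/-- The linear coefficient of an element of the algebra at a generator. -/
def lin (u : Matrix.unitaryGroup (Fin n × Fin m) ℂ) (p : Fin n ⊕ Fin m) : algA u →L[ℂ] ℂ :=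
  ((innerSL ℂ (ketOne p)).comp (ContinuousLinearMap.apply ℂ (Fock n m) vac)).comp
    (algA u).toSubmodule.subtypeL

theorem lin_apply (p : Fin n ⊕ Fin m) (a : algA u) :
    lin u p a = inner ℂ (ketOne p) (a.1 vac) := rfl

theorem lin_gen (p q : Fin n ⊕ Fin m) : lin u p (gen u q) = if p = q then 1 else 0 := by
  rw [lin_apply, gen_vac, inner_ketOne]

theorem inner_ketOne_gen (p q : Fin n ⊕ Fin m) (x : Fock n m) :
    inner ℂ (ketOne p) ((gen u q).1 x) = if p = q then (inner ℂ vac x : ℂ) else 0 := by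
  rw [← gen_vac (u := u)]
  rcases p with i | j <;> rcases q with k | l
  · simp only [Sum.inl.injEq]
    exact rowIsometric_Le i k vac x
  · rw [gen_vac, ← inner_conj_symm, if_neg Sum.inl_ne_inr]
    exact (congrArg _ (inner_Lf_ket_nil u l x [i])).trans (map_zero _)
  · rw [gen_vac, ← inner_conj_symm, if_neg Sum.inr_ne_inl]
    exact (congrArg _ (inner_Le_ket_nil k x [j])).trans (map_zero _)
  · simp only [Sum.inr.injEq]
    exact rowIsometric_Lf u j l vac x

/-- The span of `vac` and `ketOne p` is invariant under adjoints, and on it the algebra acts by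
triangular two by two matrices. The off-diagonal entry is `lin`, which is why it is a point
derivation. -/
theorem inner_ketOne_apply (p : Fin n ⊕ Fin m) (a : algA u) (x : Fock n m) :
    inner ℂ (ketOne p) (a.1 x) =
      vacChar u a * (inner ℂ (ketOne p) x : ℂ) + lin u p a * (inner ℂ vac x : ℂ) := by
  have hv : inner ℂ (ketOne p) (vac : Fock n m) = (0 : ℂ) := by
    rcases p with i | j <;> simp [ketOne, vac, inner_ket]
  let C : Subalgebra ℂ (algA u) :=
    { carrier := {a | ∀ x, inner ℂ (ketOne p) (a.1 x) =
        vacChar u a * (inner ℂ (ketOne p) x : ℂ) + lin u p a * (inner ℂ vac x : ℂ)}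
      mul_mem' := fun {a b} ha hb x => by
        have e : ∀ x, inner ℂ (ketOne p) ((a * b).1 x) =
            vacChar u a * (vacChar u b * (inner ℂ (ketOne p) x : ℂ) +
              lin u p b * (inner ℂ vac x : ℂ)) + lin u p a * (vacChar u b * inner ℂ vac x) := by
          intro x
          change inner ℂ (ketOne p) (a.1 (b.1 x)) = _
          rw [ha, hb, inner_vac_apply]
        rw [lin_apply p (a * b), e, e, map_mul, hv, inner_vac_vac]
        ring
      add_mem' := fun {a b} ha hb x => by
        rw [map_add, map_add]
        change inner ℂ (ketOne p) (a.1 x + b.1 x) = _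
        rw [inner_add_right, ha, hb]
        ring
      algebraMap_mem' := fun r x => by
        have e : ∀ x, inner ℂ (ketOne p) ((algebraMap ℂ (algA u) r).1 x) =
            r * (inner ℂ (ketOne p) x : ℂ) := by
          intro x
          change inner ℂ (ketOne p) ((algebraMap ℂ (Fock n m →L[ℂ] Fock n m) r) x) = _
          rw [Algebra.algebraMap_eq_smul_one, smul_apply, one_apply_eq_self, inner_smul_right]
        rw [lin_apply, e, e, hv, AlgHomClass.commutes]
        simp }
  refine gen_induction C ?_ (fun q x => ?_) a x
  · have : (C : Set (algA u)) = ⋂ x, {a : algA u | inner ℂ (ketOne p) (a.1 x) =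
        vacChar u a * (inner ℂ (ketOne p) x : ℂ) + lin u p a * (inner ℂ vac x : ℂ)} := by
      ext a
      simp only [Set.mem_iInter, Set.mem_ofPred_eq]
      rfl
    rw [this]
    refine isClosed_iInter fun x => isClosed_eq (continuous_inner_apply _ x) ?_
    refine Continuous.add ?_ ((lin u p).continuous.mul_const _)
    refine Continuous.mul_const ?_ _
    exact (continuous_inner_apply vac vac).congr fun a => (vacChar_apply a).symm
  · rw [inner_ketOne_gen, vacChar_gen, lin_gen]
    split_ifs <;> simp

/-- `D` is a continuous point derivation at the character `χ`. -/
def IsPointDerivation (χ : algA u →ₐ[ℂ] ℂ) (D : algA u →L[ℂ] ℂ) : Prop :=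
  ∀ a b, D (a * b) = χ a * D b + D a * χ b

theorem isPointDerivation_lin (p : Fin n ⊕ Fin m) : IsPointDerivation (vacChar u) (lin u p) := by
  intro a b
  have h := inner_ketOne_apply p a (b.1 vac)
  rw [inner_vac_apply, inner_vac_vac, mul_one] at h
  exact h

theorem IsPointDerivation.sum {χ : algA u →ₐ[ℂ] ℂ} {ι : Type*} [Fintype ι]
    {D : ι → algA u →L[ℂ] ℂ} (h : ∀ i, IsPointDerivation χ (D i)) (c : ι → ℂ) :
    IsPointDerivation χ (∑ i, c i • D i) := by
  intro a b
  simp only [sum_apply, smul_apply, h _ a b, smul_eq_mul, Finset.mul_sum,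
    Finset.sum_mul, ← Finset.sum_add_distrib]
  exact Finset.sum_congr rfl fun i _ => by ring

theorem IsPointDerivation.sub {χ : algA u →ₐ[ℂ] ℂ} {D D' : algA u →L[ℂ] ℂ}
    (h : IsPointDerivation χ D) (h' : IsPointDerivation χ D') : IsPointDerivation χ (D - D') := by
  intro a b
  simp only [sub_apply, h a b, h' a b]
  ring

/-- The Leibniz rule and `D 1 = 0` make the kernel a closed subalgebra. -/
theorem IsPointDerivation.eq_zero {χ : algA u →ₐ[ℂ] ℂ} {D : algA u →L[ℂ] ℂ}
    (h : IsPointDerivation χ D) (h0 : ∀ p, D (gen u p) = 0) : D = 0 := by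
  have h1 : D 1 = 0 := by
    have := h 1 1
    simpa using this
  let C : Subalgebra ℂ (algA u) :=
    { carrier := {a | D a = 0}
      mul_mem' := fun {a b} ha hb => by
        change D (a * b) = 0
        rw [h, show D a = 0 from ha, show D b = 0 from hb]
        simp
      add_mem' := fun {a b} ha hb => by
        change D (a + b) = 0
        rw [map_add, show D a = 0 from ha, show D b = 0 from hb, add_zero]
      algebraMap_mem' := fun r => by
        change D _ = 0
        rw [Algebra.algebraMap_eq_smul_one, map_smul, h1, smul_zero] }
  ext a
  exact gen_induction C (isClosed_eq D.continuous continuous_const) h0 a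

theorem IsPointDerivation.ext {χ : algA u →ₐ[ℂ] ℂ} {D D' : algA u →L[ℂ] ℂ}
    (h : IsPointDerivation χ D) (h' : IsPointDerivation χ D')
    (h0 : ∀ p, D (gen u p) = D' (gen u p)) : D = D' :=
  sub_eq_zero.1 ((h.sub h').eq_zero fun p => by rw [sub_apply, h0, sub_self])

/-! ### The vacuum character composed with an isometric automorphism -/

section Isometric

variable {Φ : algA u ≃ₐ[ℂ] algA u}

/-- The functional `a ↦ lin (Φ a)`. -/
def linComp (Φ : algA u ≃ₐ[ℂ] algA u) (hΦ : Isometry Φ) (p : Fin n ⊕ Fin m) : algA u →L[ℂ] ℂ :=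
  (lin u p).comp ⟨Φ.toLinearMap, hΦ.continuous⟩

theorem linComp_apply (hΦ : Isometry Φ) (p : Fin n ⊕ Fin m) (a : algA u) :
    linComp Φ hΦ p a = lin u p (Φ a) := rfl

theorem isPointDerivation_linComp (hΦ : Isometry Φ) (p : Fin n ⊕ Fin m) :
    IsPointDerivation ((vacChar u).comp Φ.toAlgHom) (linComp Φ hΦ p) := by
  intro a b
  rw [linComp_apply, map_mul, isPointDerivation_lin]
  rfl

/-- At the image of the vacuum character the point derivations take arbitrary values on the
generators. -/
theorem exists_pointDerivation (hΦ : Isometry Φ) (c : Fin n ⊕ Fin m → ℂ) :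
    ∃ D, IsPointDerivation ((vacChar u).comp Φ.toAlgHom) D ∧ ∀ p, D (gen u p) = c p := by
  let N : Matrix (Fin n ⊕ Fin m) (Fin n ⊕ Fin m) ℂ :=
    Matrix.of fun q p => lin u p (Φ (gen u q))
  have hder : ∀ b : Fin n ⊕ Fin m → ℂ, IsPointDerivation ((vacChar u).comp Φ.toAlgHom)
      (∑ p, b p • linComp Φ hΦ p) := fun b =>
    IsPointDerivation.sum (isPointDerivation_linComp hΦ) b
  have hval : ∀ (b : Fin n ⊕ Fin m → ℂ) q,
      (∑ p, b p • linComp Φ hΦ p) (gen u q) = N.mulVec b q := by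
    intro b q
    simp only [sum_apply, smul_apply, linComp_apply, smul_eq_mul, Matrix.mulVec, dotProduct, N,
      Matrix.of_apply, mul_comm]
  -- A combination of the `linComp` that vanishes on the generators vanishes everywhere. Its values
  -- at the preimages of the generators under `Φ` are the coefficients.
  have hinj : Function.Injective N.mulVecLin := by
    rw [← LinearMap.ker_eq_bot, LinearMap.ker_eq_bot']
    intro b hb
    have h0 := (hder b).eq_zero fun q => by
      rw [hval]
      exact congrFun hb q
    ext q
    have := DFunLike.congr_fun h0 (Φ.symm (gen u q))
    change b q = 0
    simpa only [sum_apply, smul_apply, linComp_apply, AlgEquiv.apply_symm_apply, lin_gen,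
      smul_eq_mul, mul_ite, mul_one, mul_zero, Finset.sum_ite_eq', Finset.mem_univ, if_true,
      zero_apply] using this
  obtain ⟨b, hb⟩ := LinearMap.surjective_of_injective hinj c
  exact ⟨_, hder b, fun p => by rw [hval]; exact congrFun hb p⟩

theorem relation_gen (u : Matrix.unitaryGroup (Fin n × Fin m) ℂ) :
    Relation u (genE u) (genF u) := by
  intro i j
  refine Subtype.ext ?_
  have := relation_shifts u i j
  simpa [genE, genF] using this

/-- The relation is differentiated by a point derivation that is zero on each `L_e` and singles out
`L_{f_l}`. -/
theorem sum_core_left (hΦ : Isometry Φ) (i : Fin n) (j l : Fin m) :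
    ∑ k, u.1 (i, j) (k, l) * vacChar u (Φ (genE u k)) =
      if j = l then vacChar u (Φ (genE u i)) else 0 := by
  obtain ⟨D, hD, hDg⟩ := exists_pointDerivation hΦ (Sum.elim 0 fun j => if j = l then 1 else 0)
  have he : ∀ k, D (genE u k) = 0 := fun k => hDg (Sum.inl k)
  have hf : ∀ k, D (genF u k) = if k = l then 1 else 0 := fun k => hDg (Sum.inr k)
  have h := congrArg D (relation_gen u i j)
  simp only [map_sum, map_smul, hD _ _, he, hf, smul_eq_mul, AlgHom.comp_apply] at h
  simpa using h.symm

theorem sum_core_right (hΦ : Isometry Φ) (i : Fin n) (j : Fin m) (k : Fin n) :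
    ∑ l, u.1 (i, j) (k, l) * vacChar u (Φ (genF u l)) =
      if i = k then vacChar u (Φ (genF u j)) else 0 := by
  obtain ⟨D, hD, hDg⟩ := exists_pointDerivation hΦ (Sum.elim (fun i => if i = k then 1 else 0) 0)
  have he : ∀ t, D (genE u t) = if t = k then 1 else 0 := fun k => hDg (Sum.inl k)
  have hf : ∀ t, D (genF u t) = 0 := fun k => hDg (Sum.inr k)
  have h := congrArg D (relation_gen u i j)
  simp only [map_sum, map_smul, hD _ _, he, hf, smul_eq_mul, AlgHom.comp_apply] at h
  rw [Finset.sum_comm] at h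
  simpa using h.symm

theorem norm_sub_sum_sq {H : Type*} [NormedAddCommGroup H] [InnerProductSpace ℂ H] {ι : Type*}
    [Fintype ι] {v : ι → H} (hv : Orthonormal ℂ v) (x : H) :
    ‖x - ∑ i, (inner ℂ (v i) x : ℂ) • v i‖ ^ 2 =
      ‖x‖ ^ 2 - ∑ i, ‖(inner ℂ (v i) x : ℂ)‖ ^ 2 := by
  classical
  have h1 : inner ℂ x (∑ i, (inner ℂ (v i) x : ℂ) • v i) =
      ((∑ i, ‖(inner ℂ (v i) x : ℂ)‖ ^ 2 : ℝ) : ℂ) := by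
    simp only [inner_sum, inner_smul_right]
    push_cast
    refine Finset.sum_congr rfl fun i _ => ?_
    rw [← inner_conj_symm x, Complex.mul_conj']
  have h2 : ‖∑ i, (inner ℂ (v i) x : ℂ) • v i‖ ^ 2 = ∑ i, ‖(inner ℂ (v i) x : ℂ)‖ ^ 2 := by
    have := hv.inner_sum (fun i => (inner ℂ (v i) x : ℂ)) (fun i => (inner ℂ (v i) x : ℂ))
      Finset.univ
    rw [inner_self_eq_norm_sq_to_K] at this
    have h3 : ∀ i, (starRingEnd ℂ) (inner ℂ (v i) x) * (inner ℂ (v i) x) =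
        ((‖(inner ℂ (v i) x : ℂ)‖ ^ 2 : ℝ) : ℂ) := fun i => by
      rw [mul_comm, Complex.mul_conj']
      push_cast
      rfl
    simp only [h3, Complex.coe_algebraMap] at this
    exact_mod_cast this
  rw [norm_sub_sq (𝕜 := ℂ), h1, h2]
  simp only [RCLike.re_to_complex, Complex.ofReal_re]
  ring

theorem norm_apply_vac_le (a : algA u) : ‖a.1 vac‖ ≤ ‖a‖ := by
  have := a.1.le_opNorm vac
  rwa [norm_vac, mul_one] at this

theorem norm_automorphism (hΦ : Isometry Φ) (a : algA u) : ‖Φ a‖ = ‖a‖ :=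
  hΦ.norm_map_of_map_zero (map_zero Φ) a

theorem isometry_symm (hΦ : Isometry Φ) : Isometry Φ.symm :=
  hΦ.right_inv Φ.apply_symm_apply

/-- Equality would force `Φ a` to map the vacuum to a multiple of itself. Then `Φ a` is scalar
because the vacuum separates, so `a` is the same scalar, which must be zero. -/
theorem norm_vacChar_lt (hΦ : Isometry Φ) {a : algA u} (h0 : vacChar u a = 0) (ha : a ≠ 0) :
    ‖vacChar u (Φ a)‖ < ‖a‖ := by
  by_contra! hle
  have ho : Orthonormal ℂ fun _ : Unit => (vac : Fock n m) :=
    ⟨fun _ => norm_vac, fun i j h => absurd (Subsingleton.elim i j) h⟩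
  have h := norm_sub_sum_sq ho ((Φ a).1 vac)
  simp only [Finset.univ_unique, Finset.sum_singleton, ← vacChar_apply] at h
  have h2 : ‖(Φ a).1 vac‖ ≤ ‖a‖ := (norm_apply_vac_le _).trans_eq (norm_automorphism hΦ a)
  have h3 : ‖(Φ a).1 vac - vacChar u (Φ a) • vac‖ ^ 2 ≤ 0 := by
    rw [h]
    nlinarith [norm_nonneg ((Φ a).1 vac), norm_nonneg a]
  have h4 : (Φ a).1 vac = vacChar u (Φ a) • vac := by
    rw [← sub_eq_zero, ← norm_eq_zero]
    exact pow_eq_zero_iff two_ne_zero |>.1 (le_antisymm h3 (sq_nonneg _))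
  have h5 : Φ a = algebraMap ℂ _ (vacChar u (Φ a)) := ext_vac (by
    rw [h4]
    change _ = (algebraMap ℂ (Fock n m →L[ℂ] Fock n m) _) vac
    rw [Algebra.algebraMap_eq_smul_one, smul_apply, one_apply_eq_self])
  have h6 : a = algebraMap ℂ _ (vacChar u (Φ a)) := by
    apply Φ.injective
    rw [AlgEquiv.commutes]
    exact h5
  have h7 : vacChar u (Φ a) = 0 := by
    rw [h6, AlgHomClass.commutes] at h0
    exact h0
  exact ha (by rw [h6, h7, map_zero])

theorem norm_sum_smul_le {d : ℕ} {g : Fin d → algA u}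
    (hg : RowIsometric fun i => (g i : Fock n m →L[ℂ] Fock n m)) (c : Fin d → ℂ) :
    ‖∑ t, c t • g t‖ ≤ √(∑ t, ‖c t‖ ^ 2) := by
  have := hg.norm_sum_le c
  change ‖((∑ t, c t • g t : algA u) : Fock n m →L[ℂ] Fock n m)‖ ≤ _
  simpa using this

/-- With `z` the tuple of values, the element `∑ z̄_i g_i` has norm at most `‖z‖` and is sent to
`‖z‖²`. If it is nonzero, `‖z‖² < ‖z‖`. -/
theorem sum_norm_vacChar_lt (hΦ : Isometry Φ) {d : ℕ} {g : Fin d → algA u}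
    (hg : RowIsometric fun i => (g i : Fock n m →L[ℂ] Fock n m))
    (h0 : ∀ i, vacChar u (g i) = 0) : ∑ i, ‖vacChar u (Φ (g i))‖ ^ 2 < 1 := by
  set z : Fin d → ℂ := fun i => vacChar u (Φ (g i)) with hz
  set a : algA u := ∑ t, star (z t) • g t with ha
  have hχ : vacChar u (Φ a) = ((∑ i, ‖z i‖ ^ 2 : ℝ) : ℂ) := by
    simp only [ha, map_sum, map_smul, smul_eq_mul]
    push_cast
    refine Finset.sum_congr rfl fun i _ => ?_
    rw [mul_comm]
    exact Complex.mul_conj' _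
  have hpos : 0 ≤ ∑ i, ‖z i‖ ^ 2 := by positivity
  have hle := norm_sum_smul_le hg fun t => star (z t)
  simp only [norm_star] at hle
  by_cases h : a = 0
  · rw [h, map_zero, map_zero] at hχ
    have : ∑ i, ‖z i‖ ^ 2 = 0 := by exact_mod_cast hχ.symm
    change ∑ i, ‖z i‖ ^ 2 < 1
    rw [this]
    exact one_pos
  · have hlt := norm_vacChar_lt hΦ (a := a) (by simp [ha, h0]) h
    rw [hχ, Complex.norm_real, Real.norm_of_nonneg hpos] at hlt
    have h2 := hlt.trans_le hle
    change ∑ i, ‖z i‖ ^ 2 < 1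
    by_contra! h3
    have h4 : √(∑ i, ‖z i‖ ^ 2) ≤ ∑ i, ‖z i‖ ^ 2 :=
      Real.sqrt_le_iff.2 ⟨hpos, by nlinarith⟩
    exact absurd (h2.trans_le h4) (lt_irrefl _)

end Isometric

/-! ### Automorphisms that fix the vacuum character -/

section Matrices

/-- A matrix and its inverse whose rows have norm at most one are adjoint to each other. -/
theorem eq_star_of_rows {ι : Type*} [Fintype ι] [DecidableEq ι] {M M' : Matrix ι ι ℂ}
    (h : M' * M = 1) (hM : ∀ q, ∑ p, ‖M q p‖ ^ 2 ≤ 1) (hM' : ∀ q, ∑ p, ‖M' q p‖ ^ 2 ≤ 1) :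
    M = star M' := by
  have hnorm : ∀ a b : ℂ, ‖a - star b‖ ^ 2 = ‖a‖ ^ 2 + ‖b‖ ^ 2 - 2 * (b * a).re := by
    intro a b
    simp only [← Complex.normSq_eq_norm_sq, Complex.normSq_apply]
    simp
    ring
  have htr : ∑ p, ∑ q, (M' p q * M q p).re = Fintype.card ι := by
    have h1 := congrArg (fun X => (Matrix.trace X).re) h
    simpa [Matrix.trace, Matrix.mul_apply, Complex.re_sum] using h1
  have hsum : ∑ q, ∑ p, ‖M q p - star (M' p q)‖ ^ 2 ≤ 0 := by
    simp only [hnorm, Finset.sum_sub_distrib, Finset.sum_add_distrib, ← Finset.mul_sum]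
    rw [Finset.sum_comm (f := fun q p => ‖M' p q‖ ^ 2),
      Finset.sum_comm (f := fun q p => (M' p q * M q p).re), htr]
    have h1 : ∑ q, ∑ p, ‖M q p‖ ^ 2 ≤ Fintype.card ι := by
      refine (Finset.sum_le_sum fun q _ => hM q).trans_eq ?_
      simp
    have h2 : ∑ q, ∑ p, ‖M' q p‖ ^ 2 ≤ Fintype.card ι := by
      refine (Finset.sum_le_sum fun q _ => hM' q).trans_eq ?_
      simp
    linarith
  ext q p
  have h0 := (Finset.sum_eq_zero_iff_of_nonneg
    (fun q _ => Finset.sum_nonneg fun p _ => sq_nonneg _)).1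
    (le_antisymm hsum (Finset.sum_nonneg fun q _ => Finset.sum_nonneg fun p _ => sq_nonneg _))
    q (Finset.mem_univ q)
  have h1 := (Finset.sum_eq_zero_iff_of_nonneg (fun p _ => sq_nonneg _)).1 h0 p (Finset.mem_univ p)
  rw [Matrix.star_apply, ← sub_eq_zero, ← norm_eq_zero]
  exact pow_eq_zero_iff two_ne_zero |>.1 h1

theorem sum_norm_sq_row {ι : Type*} [Fintype ι] [DecidableEq ι] {M : Matrix ι ι ℂ}
    (hM : M ∈ Matrix.unitaryGroup ι ℂ) (q : ι) : ∑ p, ‖M q p‖ ^ 2 = 1 := by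
  have h := congrFun (congrFun (Matrix.mem_unitaryGroup_iff.1 hM) q) q
  rw [Matrix.mul_apply, Matrix.one_apply_eq] at h
  simp only [Matrix.star_apply] at h
  have h2 : ∀ p, M q p * star (M q p) = ((‖M q p‖ ^ 2 : ℝ) : ℂ) := fun p => by
    push_cast
    exact Complex.mul_conj' _
  simp only [h2] at h
  exact_mod_cast h

theorem sum_norm_sq_mulVec {ι : Type*} [Fintype ι] [DecidableEq ι] {M : Matrix ι ι ℂ}
    (hM : M ∈ Matrix.unitaryGroup ι ℂ) (v : ι → ℂ) :
    ∑ p, ‖M.mulVec v p‖ ^ 2 = ∑ p, ‖v p‖ ^ 2 := by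
  have h : star (M.mulVec v) ⬝ᵥ M.mulVec v = star v ⬝ᵥ v := by
    rw [Matrix.star_mulVec, ← Matrix.dotProduct_mulVec, Matrix.mulVec_mulVec]
    have := Matrix.mem_unitaryGroup_iff'.1 hM
    rw [Matrix.star_eq_conjTranspose] at this
    rw [this, Matrix.one_mulVec]
  have h2 : ∀ x : ι → ℂ, star x ⬝ᵥ x = ((∑ p, ‖x p‖ ^ 2 : ℝ) : ℂ) := fun x => by
    push_cast
    refine Finset.sum_congr rfl fun p _ => ?_
    rw [mul_comm]
    exact Complex.mul_conj' _
  rw [h2, h2] at h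
  exact_mod_cast h

theorem exists_mulVec_ne_zero {ι κ : Type*} [Fintype ι] [DecidableEq ι] {X : Matrix κ ι ℂ}
    (hX : X ≠ 0) : ∃ v, X.mulVec v ≠ 0 := by
  by_contra! h0
  exact hX (Matrix.ext fun i j => by simpa using congrFun (h0 (Pi.single j 1)) i)

/-- A vector space is not the union of two proper subspaces, here the two kernels. -/
theorem mulVec_eq_zero_or {ι κ ν : Type*} [Fintype ι] [DecidableEq ι] (X : Matrix κ ι ℂ)
    (Y : Matrix ν ι ℂ) (h : ∀ v, X.mulVec v = 0 ∨ Y.mulVec v = 0) : X = 0 ∨ Y = 0 := by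
  by_contra! hXY
  obtain ⟨x, hx⟩ := exists_mulVec_ne_zero hXY.1
  obtain ⟨y, hy⟩ := exists_mulVec_ne_zero hXY.2
  have hx' := (h x).resolve_left hx
  have hy' := (h y).resolve_right hy
  rcases h (x + y) with h1 | h1
  · rw [Matrix.mulVec_add, hy', add_zero] at h1
    exact hx h1
  · rw [Matrix.mulVec_add, hx', zero_add] at h1
    exact hy h1

open scoped ComplexOrder in
/-- A unitary block matrix with a zero block in the first column and one in the second column is
block diagonal or block antidiagonal. -/
theorem blocks_of_unitary {P : Matrix (Fin n) (Fin n) ℂ} {Q : Matrix (Fin n) (Fin m) ℂ}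
    {R : Matrix (Fin m) (Fin n) ℂ} {S : Matrix (Fin m) (Fin m) ℂ}
    (hM : Matrix.fromBlocks P Q R S ∈ Matrix.unitaryGroup (Fin n ⊕ Fin m) ℂ)
    (h1 : P = 0 ∨ R = 0) (h2 : Q = 0 ∨ S = 0) :
    (Q = 0 ∧ R = 0 ∧ P * star P = 1 ∧ S * star S = 1) ∨
      (P = 0 ∧ S = 0 ∧ Q * Q.conjTranspose = 1 ∧ R * R.conjTranspose = 1 ∧ n = m) := by
  have hA := Matrix.mem_unitaryGroup_iff.1 hM
  have hB := Matrix.mem_unitaryGroup_iff'.1 hM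
  rw [Matrix.star_eq_conjTranspose, Matrix.fromBlocks_conjTranspose, Matrix.fromBlocks_multiply,
    ← Matrix.fromBlocks_one, Matrix.fromBlocks_inj] at hA hB
  obtain ⟨a11, -, -, a22⟩ := hA
  obtain ⟨b11, -, -, b22⟩ := hB
  -- If `Q = 0`, the first row gives `P P* = 1`, so `P* P = 1`, and the first column leaves `R* R =
  -- 0`. The other case is dual.
  have key : Q = 0 ∨ R = 0 → Q = 0 ∧ R = 0 := by
    rintro (h | h)
    · refine ⟨h, ?_⟩
      rw [h, Matrix.zero_mul, add_zero, mul_eq_one_comm] at a11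
      rw [a11] at b11
      exact Matrix.conjTranspose_mul_self_eq_zero.1 (by simpa using b11)
    · refine ⟨?_, h⟩
      rw [h, Matrix.mul_zero, add_zero, mul_eq_one_comm] at b11
      rw [b11] at a11
      exact Matrix.self_mul_conjTranspose_eq_zero.1 (by simpa using a11)
  by_cases hQR : Q = 0 ∨ R = 0
  · obtain ⟨hQ, hR⟩ := key hQR
    refine Or.inl ⟨hQ, hR, ?_, ?_⟩
    · simpa [hQ, Matrix.star_eq_conjTranspose] using a11
    · simpa [hR, Matrix.star_eq_conjTranspose] using a22
  · push Not at hQR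
    have hP := h1.resolve_right hQR.2
    have hS := h2.resolve_left hQR.1
    have e1 : Q * Q.conjTranspose = 1 := by simpa [hP] using a11
    have e2 : Q.conjTranspose * Q = 1 := by simpa [hS] using b22
    refine Or.inr ⟨hP, hS, e1, by simpa [hS] using a22, ?_⟩
    have ht := Matrix.trace_mul_comm Q Q.conjTranspose
    rw [e1, e2] at ht
    simpa using ht

end Matrices

/-! ### The matrix of linear parts -/

theorem norm_gen_le (p : Fin n ⊕ Fin m) : ‖gen u p‖ ≤ 1 := by
  rcases p with i | j
  · exact LinearIsometry.norm_toContinuousLinearMap_le _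
  · exact LinearIsometry.norm_toContinuousLinearMap_le _

/-- The matrix of the linear parts of the images of the generators. -/
def linMatrix (Φ : algA u ≃ₐ[ℂ] algA u) : Matrix (Fin n ⊕ Fin m) (Fin n ⊕ Fin m) ℂ :=
  Matrix.of fun q p => lin u p (Φ (gen u q))

theorem sum_norm_linMatrix_le {Φ : algA u ≃ₐ[ℂ] algA u} (hΦ : Isometry Φ) (q : Fin n ⊕ Fin m) :
    ∑ p, ‖linMatrix Φ q p‖ ^ 2 ≤ 1 := by
  have h := orthonormal_ketOne.sum_inner_products_le ((Φ (gen u q)).1 vac) (s := Finset.univ)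
  have h2 : ‖(Φ (gen u q)).1 vac‖ ≤ 1 :=
    (norm_apply_vac_le _).trans ((norm_automorphism hΦ _).trans_le (norm_gen_le q))
  exact h.trans (pow_le_one₀ (norm_nonneg _) h2)

/-- The chain rule: `lin p ∘ Φ` is a point derivation at the vacuum character, hence a combination
of the `lin r`, and it is evaluated at `Φ.symm (gen u q)`. -/
theorem linMatrix_symm_mul {Φ : algA u ≃ₐ[ℂ] algA u} (hΦ : Isometry Φ)
    (h0 : ∀ a, vacChar u (Φ a) = vacChar u a) : linMatrix Φ.symm * linMatrix Φ = 1 := by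
  ext q p
  have hχ : (vacChar u).comp Φ.toAlgHom = vacChar u := AlgHom.ext h0
  have hD := isPointDerivation_linComp hΦ p
  rw [hχ] at hD
  have he := hD.ext (IsPointDerivation.sum (isPointDerivation_lin (u := u))
    fun r => linMatrix Φ r p) fun r => by
      simp only [linComp_apply, sum_apply, smul_apply, lin_gen, smul_eq_mul, mul_ite, mul_one,
        mul_zero, Finset.sum_ite_eq', Finset.mem_univ, if_true]
      rfl
  have h := DFunLike.congr_fun he (Φ.symm (gen u q))
  rw [linComp_apply, AlgEquiv.apply_symm_apply, lin_gen] at h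
  rw [Matrix.mul_apply, Matrix.one_apply]
  simp only [eq_comm (a := q)]
  rw [h]
  simp only [sum_apply, smul_apply, smul_eq_mul]
  exact Finset.sum_congr rfl fun r _ => mul_comm _ _

theorem vacChar_symm {Φ : algA u ≃ₐ[ℂ] algA u} (h0 : ∀ a, vacChar u (Φ a) = vacChar u a)
    (a : algA u) : vacChar u (Φ.symm a) = vacChar u a := by
  rw [← h0, AlgEquiv.apply_symm_apply]

theorem linMatrix_eq_star {Φ : algA u ≃ₐ[ℂ] algA u} (hΦ : Isometry Φ)
    (h0 : ∀ a, vacChar u (Φ a) = vacChar u a) : linMatrix Φ = star (linMatrix Φ.symm) :=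
  eq_star_of_rows (linMatrix_symm_mul hΦ h0) (sum_norm_linMatrix_le hΦ)
    (sum_norm_linMatrix_le (isometry_symm hΦ))

theorem linMatrix_mem_unitaryGroup {Φ : algA u ≃ₐ[ℂ] algA u} (hΦ : Isometry Φ)
    (h0 : ∀ a, vacChar u (Φ a) = vacChar u a) :
    linMatrix Φ ∈ Matrix.unitaryGroup (Fin n ⊕ Fin m) ℂ := by
  rw [Matrix.mem_unitaryGroup_iff', linMatrix_eq_star hΦ h0, star_star,
    ← linMatrix_eq_star hΦ h0, linMatrix_symm_mul hΦ h0]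

/-- The linear part of `Φ (gen u q)` at the vacuum already has norm one, while the whole vector has
norm at most one. Nothing else remains, and the vacuum separates. -/
theorem apply_gen_eq_sum {Φ : algA u ≃ₐ[ℂ] algA u} (hΦ : Isometry Φ)
    (h0 : ∀ a, vacChar u (Φ a) = vacChar u a) (q : Fin n ⊕ Fin m) :
    Φ (gen u q) = ∑ p, linMatrix Φ q p • gen u p := by
  have hM := sum_norm_sq_row (linMatrix_mem_unitaryGroup hΦ h0) q
  have h := norm_sub_sum_sq orthonormal_ketOne ((Φ (gen u q)).1 vac)
  have h2 : ‖(Φ (gen u q)).1 vac‖ ≤ 1 :=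
    (norm_apply_vac_le _).trans ((norm_automorphism hΦ _).trans_le (norm_gen_le q))
  have e : ∀ p, (inner ℂ (ketOne p) ((Φ (gen u q)).1 vac) : ℂ) = linMatrix Φ q p := fun p => rfl
  simp only [e, hM] at h
  have h3 : ‖(Φ (gen u q)).1 vac - ∑ p, linMatrix Φ q p • ketOne p‖ ^ 2 ≤ 0 := by
    rw [h, sub_nonpos]
    exact pow_le_one₀ (norm_nonneg _) h2
  have h4 : (Φ (gen u q)).1 vac = ∑ p, linMatrix Φ q p • ketOne p := by
    rw [← sub_eq_zero, ← norm_eq_zero]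
    exact pow_eq_zero_iff two_ne_zero |>.1 (le_antisymm h3 (sq_nonneg _))
  refine ext_vac ?_
  rw [h4]
  simp only [AddSubmonoidClass.coe_finsetSum, Subalgebra.coe_smul, sum_apply, smul_apply, gen_vac]

/-! ### Evaluation characters -/

/-- `u (z ⊗ w) = z ⊗ w` for the vector `v = (z, w)`. -/
def FixedTensor (u : Matrix.unitaryGroup (Fin n × Fin m) ℂ) (v : Fin n ⊕ Fin m → ℂ) : Prop :=
  ∀ i j, v (Sum.inl i) * v (Sum.inr j) =
    ∑ k, ∑ l, u.1 (i, j) (k, l) * (v (Sum.inr l) * v (Sum.inl k))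

theorem fixedTensor_character (χ : algA u →ₐ[ℂ] ℂ) : FixedTensor u fun p => χ (gen u p) := by
  intro i j
  have h := congrArg χ (relation_gen u i j)
  simp only [map_mul, map_sum, map_smul, smul_eq_mul] at h
  exact h

theorem FixedTensor.smul {v : Fin n ⊕ Fin m → ℂ} (h : FixedTensor u v) (c : ℂ) :
    FixedTensor u (c • v) := by
  intro i j
  simp only [Pi.smul_apply, smul_eq_mul]
  have := congrArg (fun x => c ^ 2 * x) (h i j)
  simp only [Finset.mul_sum] at this
  convert this using 1
  · ring
  · exact Finset.sum_congr rfl fun k _ => Finset.sum_congr rfl fun l _ => by ring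

/-- The squared norm of the first component. -/
def sqE (v : Fin n ⊕ Fin m → ℂ) : ℝ := ∑ i, ‖v (Sum.inl i)‖ ^ 2

/-- The squared norm of the second component. -/
def sqF (v : Fin n ⊕ Fin m → ℂ) : ℝ := ∑ j, ‖v (Sum.inr j)‖ ^ 2

theorem sqE_nonneg (v : Fin n ⊕ Fin m → ℂ) : 0 ≤ sqE v := by unfold sqE; positivity

theorem sqF_nonneg (v : Fin n ⊕ Fin m → ℂ) : 0 ≤ sqF v := by unfold sqF; positivity

theorem sqE_smul (c : ℂ) (v : Fin n ⊕ Fin m → ℂ) : sqE (c • v) = ‖c‖ ^ 2 * sqE v := by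
  simp [sqE, mul_pow, Finset.mul_sum]

theorem sqF_smul (c : ℂ) (v : Fin n ⊕ Fin m → ℂ) : sqF (c • v) = ‖c‖ ^ 2 * sqF v := by
  simp [sqF, mul_pow, Finset.mul_sum]

instance : Nontrivial (Fock n m) := ⟨⟨vac, 0, vac_ne_zero⟩⟩

instance (u : Matrix.unitaryGroup (Fin n × Fin m) ℂ) : NormOneClass (algA u) :=
  ⟨(norm_one : ‖(1 : Fock n m →L[ℂ] Fock n m)‖ = 1)⟩

theorem sum_norm_character_le (χ : algA u →ₐ[ℂ] ℂ) {d : ℕ} {g : Fin d → algA u}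
    (hg : RowIsometric fun i => (g i : Fock n m →L[ℂ] Fock n m)) : ∑ i, ‖χ (g i)‖ ^ 2 ≤ 1 := by
  set z : Fin d → ℂ := fun i => χ (g i) with hz
  have hχ : χ (∑ t, star (z t) • g t) = ((∑ i, ‖z i‖ ^ 2 : ℝ) : ℂ) := by
    simp only [map_sum, map_smul, smul_eq_mul]
    push_cast
    refine Finset.sum_congr rfl fun i _ => ?_
    rw [mul_comm]
    exact Complex.mul_conj' _
  have hpos : 0 ≤ ∑ i, ‖z i‖ ^ 2 := by positivity
  have hle := norm_sum_smul_le hg fun t => star (z t)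
  simp only [norm_star] at hle
  have h := AlgHom.norm_apply_le_self χ (∑ t, star (z t) • g t)
  rw [hχ, Complex.norm_real, Real.norm_of_nonneg hpos] at h
  have h2 := h.trans hle
  change ∑ i, ‖z i‖ ^ 2 ≤ 1
  rw [Real.le_sqrt hpos hpos] at h2
  nlinarith

theorem sqE_character_le (χ : algA u →ₐ[ℂ] ℂ) : sqE (fun p => χ (gen u p)) ≤ 1 :=
  sum_norm_character_le χ (g := genE u) rowIsometric_Le

theorem sqF_character_le (χ : algA u →ₐ[ℂ] ℂ) : sqF (fun p => χ (gen u p)) ≤ 1 :=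
  sum_norm_character_le χ (g := genF u) (rowIsometric_Lf u)

/-- If `ω = ζ + L_{z̄} ω` with `ζ` orthogonal to the ranges of the row isometry `L`, then `ω` is a
joint eigenvector of the adjoints. -/
theorem RowIsometric.inner_apply_of_eq_add {H : Type*} [NormedAddCommGroup H]
    [InnerProductSpace ℂ H] {d : ℕ} {L : Fin d → H →L[ℂ] H} (hL : RowIsometric L) {z : Fin d → ℂ}
    {ω ζ : H} (hω : ω = ζ + (∑ t, star (z t) • L t) ω)
    (hζ : ∀ i x, inner ℂ (L i x) ζ = (0 : ℂ)) (i : Fin d) (x : H) :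
    inner ℂ ω (L i x) = z i * (inner ℂ ω x : ℂ) := by
  have h : inner ℂ (L i x) ω = star (z i) * (inner ℂ x ω : ℂ) := by
    conv_lhs => rw [hω]
    simp [hζ, sum_apply, hL _ _ _ _]
  rw [← inner_conj_symm, h, map_mul, inner_conj_symm]
  simp

/-- The eigenvector is `(1 - L_{z̄})⁻¹ (1 - L_{w̄})⁻¹ Ω`. The condition `u (z ⊗ w) = z ⊗ w` makes
the two operators commute, so it can be expanded with either resolvent outermost. -/
theorem exists_evaluation {v : Fin n ⊕ Fin m → ℂ} (hv : FixedTensor u v) (hE : sqE v < 1)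
    (hF : sqF v < 1) : ∃ χ : algA u →ₐ[ℂ] ℂ, ∀ p, χ (gen u p) = v p := by
  set a : Fock n m →L[ℂ] Fock n m := ∑ t, star (v (Sum.inl t)) • Le t with ha
  set b : Fock n m →L[ℂ] Fock n m := ∑ t, star (v (Sum.inr t)) • Lf u t with hb
  have hab : Commute a b := by
    refine Commute.symm ?_
    rw [commute_iff_eq, ha, hb, Finset.sum_mul_sum, Finset.sum_mul_sum]
    simp only [smul_mul_smul_comm, (relation_shifts u).swap, Finset.smul_sum, smul_smul]
    rw [Finset.sum_comm]
    have e : ∀ k l, ∑ i, ∑ j, (star (v (Sum.inr l)) * star (v (Sum.inl k)) *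
        star (u.1 (i, j) (k, l))) • (Le i * Lf u j) = ∑ p : Fin n × Fin m,
          star (u.1 p (k, l) * (v (Sum.inr l) * v (Sum.inl k))) • (Le p.1 * Lf u p.2) := by
      intro k l
      rw [Fintype.sum_prod_type]
      simp only [star_mul', mul_comm]
    simp only [e]
    rw [← Fintype.sum_prod_type' (f := fun k l => ∑ p : Fin n × Fin m,
      star (u.1 p (k, l) * (v (Sum.inr l) * v (Sum.inl k))) • (Le p.1 * Lf u p.2)),
      Finset.sum_comm, Fintype.sum_prod_type]
    simp only [← Finset.sum_smul, ← star_sum, Fintype.sum_prod_type, ← hv _ _]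
    simp only [star_mul']
  have hlt : ∀ {d : ℕ} {L : Fin d → Fock n m →L[ℂ] Fock n m} {c : Fin d → ℂ}, RowIsometric L →
      ∑ t, ‖c t‖ ^ 2 < 1 → ‖∑ t, star (c t) • L t‖ < ‖(1 : ℂ)‖ := by
    intro d L c hL hc
    refine (hL.norm_sum_le _).trans_lt ?_
    rw [norm_one, Real.sqrt_lt' one_pos]
    simpa using hc
  obtain ⟨r, hrC, hr1, hr2⟩ := exists_inverse_mem (closedAlg (Le (m := m)))
    (Subalgebra.isClosed_topologicalClosure _)
    (Subalgebra.sum_mem _ fun t _ => Subalgebra.smul_mem _ (mem_closedAlg Le t) _)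
    (hlt rowIsometric_Le hE)
  obtain ⟨s, hsC, hs1, hs2⟩ := exists_inverse_mem (closedAlg (Lf u))
    (Subalgebra.isClosed_topologicalClosure _)
    (Subalgebra.sum_mem _ fun t _ => Subalgebra.smul_mem _ (mem_closedAlg (Lf u) t) _)
    (hlt (rowIsometric_Lf u) hF)
  rw [← ha, one_smul] at hr1 hr2
  rw [← hb, one_smul] at hs1 hs2
  have hrs : Commute r s := by
    refine commute_of_inverse hr1 hr2 (Commute.symm (commute_of_inverse hs1 hs2 ?_))
    exact (Commute.one_left _).sub_left ((Commute.one_right _).sub_right hab.symm)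
  -- The shape required by `inner_apply_of_eq_add`, with `s vac` in `spanF` and thus orthogonal to
  -- the ranges of the `Le i`. The expansion `hse` serves the `Lf` in the same way.
  have hre : r (s vac) = s vac + a (r (s vac)) := by
    have := DFunLike.congr_fun hr2 (s vac)
    simp only [mul_apply_eq_comp, sub_apply, one_apply_eq_self] at this
    exact sub_eq_iff_eq_add.1 this
  have hsr : r (s vac) = s (r vac) := DFunLike.congr_fun hrs.eq vac
  have hse : r (s vac) = r vac + b (r (s vac)) := by
    have := DFunLike.congr_fun hs2 (r vac)
    simp only [mul_apply_eq_comp, sub_apply, one_apply_eq_self, ← hsr] at this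
    exact sub_eq_iff_eq_add.1 this
  have hne : r (s vac) ≠ 0 := by
    intro h0
    have h1 : s vac = 0 := by simpa [h0] using hre.symm
    have h2 := DFunLike.congr_fun hs2 vac
    rw [mul_apply_eq_comp, h1, map_zero, one_apply_eq_self] at h2
    exact vac_ne_zero h2.symm
  obtain ⟨χ, -, hχ⟩ := exists_character (u := u) (c := v) hne (by
    rintro (i | j) x
    · exact rowIsometric_Le.inner_apply_of_eq_add (z := fun i => v (Sum.inl i)) hre
        (fun i x => inner_eq_zero_of_mem_spanF (apply_mem_spanF hsC (ket_mem_spanF [])) i x) i x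
    · exact (rowIsometric_Lf u).inner_apply_of_eq_add (z := fun i => v (Sum.inr i)) hse
        (fun i x => inner_eq_zero_of_mem_spanE u (apply_mem_spanE hrC (ket_mem_spanE [])) i x) j x)
  exact ⟨χ, hχ⟩

/-- A scaled copy of `v` is the value of a character `χ`, and `M v` is then a multiple of the values
of `χ ∘ Φ`, which satisfy the constraints on characters. -/
theorem fixedTensor_mulVec {Φ : algA u ≃ₐ[ℂ] algA u}
    {M : Matrix (Fin n ⊕ Fin m) (Fin n ⊕ Fin m) ℂ}
    (hM : ∀ q, Φ (gen u q) = ∑ p, M q p • gen u p) {v : Fin n ⊕ Fin m → ℂ}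
    (hv : FixedTensor u v) : FixedTensor u (M.mulVec v) ∧
      sqE (M.mulVec v) ≤ max (sqE v) (sqF v) ∧ sqF (M.mulVec v) ≤ max (sqE v) (sqF v) := by
  -- Evaluation needs norms strictly below one, so `v` is divided by `√t` with `t` above the
  -- maximum; at the end `t` decreases to it.
  have key : ∀ t, max (sqE v) (sqF v) < t → FixedTensor u (M.mulVec v) ∧
      sqE (M.mulVec v) ≤ t ∧ sqF (M.mulVec v) ≤ t := by
    intro t ht
    have htpos : 0 < t := (le_max_of_le_left (sqE_nonneg v)).trans_lt ht
    have hc : (√t : ℂ) ≠ 0 := by exact_mod_cast (Real.sqrt_pos.2 htpos).ne'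
    have hn : ‖(√t : ℂ)⁻¹‖ ^ 2 = t⁻¹ := by
      rw [norm_inv, Complex.norm_real, inv_pow, Real.norm_of_nonneg (Real.sqrt_nonneg _),
        Real.sq_sqrt htpos.le]
    have hn' : ‖(√t : ℂ)‖ ^ 2 = t := by
      rw [Complex.norm_real, Real.norm_of_nonneg (Real.sqrt_nonneg _), Real.sq_sqrt htpos.le]
    obtain ⟨χ, hχ⟩ := exists_evaluation (hv.smul (√t : ℂ)⁻¹)
      (by rw [sqE_smul, hn, inv_mul_lt_iff₀ htpos, mul_one]; exact (le_max_left _ _).trans_lt ht)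
      (by rw [sqF_smul, hn, inv_mul_lt_iff₀ htpos, mul_one]; exact (le_max_right _ _).trans_lt ht)
    have hval : M.mulVec v = (√t : ℂ) • fun p => (χ.comp Φ.toAlgHom) (gen u p) := by
      ext q
      have : (χ.comp Φ.toAlgHom) (gen u q) = χ (Φ (gen u q)) := rfl
      simp only [Pi.smul_apply, this, hM, map_sum, map_smul, hχ, smul_eq_mul, Matrix.mulVec,
        dotProduct, Finset.mul_sum]
      refine Finset.sum_congr rfl fun p _ => ?_
      field_simp
    rw [hval]
    refine ⟨(fixedTensor_character _).smul _, ?_, ?_⟩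
    · rw [sqE_smul, hn']
      exact mul_le_of_le_one_right htpos.le (sqE_character_le _)
    · rw [sqF_smul, hn']
      exact mul_le_of_le_one_right htpos.le (sqF_character_le _)
  exact ⟨(key _ (lt_add_one _)).1, le_of_forall_gt_imp_ge_of_dense fun t ht => (key t ht).2.1,
    le_of_forall_gt_imp_ge_of_dense fun t ht => (key t ht).2.2⟩

/-- Applying the inverse shows that the maximum of the two squared norms does not drop, and
unitarity preserves their sum. If the maximum equals the sum before, it does so afterwards. -/
theorem sqE_eq_zero_or_sqF_eq_zero {Φ : algA u ≃ₐ[ℂ] algA u} (hΦ : Isometry Φ)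
    (h0 : ∀ a, vacChar u (Φ a) = vacChar u a) {v : Fin n ⊕ Fin m → ℂ} (hv : FixedTensor u v)
    (h : sqE v = 0 ∨ sqF v = 0) :
    sqE ((linMatrix Φ).mulVec v) = 0 ∨ sqF ((linMatrix Φ).mulVec v) = 0 := by
  obtain ⟨hfix, -, -⟩ := fixedTensor_mulVec (apply_gen_eq_sum hΦ h0) hv
  have hback := fixedTensor_mulVec (apply_gen_eq_sum (isometry_symm hΦ) (vacChar_symm h0)) hfix
  rw [Matrix.mulVec_mulVec, linMatrix_symm_mul hΦ h0, Matrix.one_mulVec] at hback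
  have hsum := sum_norm_sq_mulVec (linMatrix_mem_unitaryGroup hΦ h0) v
  rw [Fintype.sum_sum_type, Fintype.sum_sum_type] at hsum
  change sqE _ + sqF _ = sqE v + sqF v at hsum
  have hE := sqE_nonneg ((linMatrix Φ).mulVec v)
  have hF := sqF_nonneg ((linMatrix Φ).mulVec v)
  have h1 := hback.2.1
  have h2 := hback.2.2
  rcases le_total (sqE ((linMatrix Φ).mulVec v)) (sqF ((linMatrix Φ).mulVec v)) with hle | hle
  · rw [max_eq_right hle] at h1 h2
    rcases h with h | h <;> left <;> linarith
  · rw [max_eq_left hle] at h1 h2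
    rcases h with h | h <;> right <;> linarith

/-- The vectors `(z, 0)` and `(0, w)` satisfy `FixedTensor` trivially. -/
theorem blocks_linMatrix {Φ : algA u ≃ₐ[ℂ] algA u} (hΦ : Isometry Φ)
    (h0 : ∀ a, vacChar u (Φ a) = vacChar u a) :
    ((linMatrix Φ).toBlocks₁₁ = 0 ∨ (linMatrix Φ).toBlocks₂₁ = 0) ∧
      ((linMatrix Φ).toBlocks₁₂ = 0 ∨ (linMatrix Φ).toBlocks₂₂ = 0) := by
  have hsqE : ∀ v : Fin n ⊕ Fin m → ℂ, sqE v = 0 → ∀ i, v (Sum.inl i) = 0 := by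
    intro v hv i
    have := (Finset.sum_eq_zero_iff_of_nonneg (fun i _ => sq_nonneg _)).1 hv i (Finset.mem_univ i)
    simpa using this
  have hsqF : ∀ v : Fin n ⊕ Fin m → ℂ, sqF v = 0 → ∀ i, v (Sum.inr i) = 0 := by
    intro v hv i
    have := (Finset.sum_eq_zero_iff_of_nonneg (fun i _ => sq_nonneg _)).1 hv i (Finset.mem_univ i)
    simpa using this
  constructor
  · refine mulVec_eq_zero_or _ _ fun z => ?_
    have h := sqE_eq_zero_or_sqF_eq_zero hΦ h0 (v := Sum.elim z 0) (fun i j => by simp)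
      (Or.inr (by simp [sqF]))
    refine h.imp (fun h => funext fun i => ?_) (fun h => funext fun i => ?_)
    · simpa [Matrix.mulVec, dotProduct, Fintype.sum_sum_type, Matrix.toBlocks₁₁,
        Matrix.toBlocks₁₂, Matrix.toBlocks₂₁, Matrix.toBlocks₂₂] using hsqE _ h i
    · simpa [Matrix.mulVec, dotProduct, Fintype.sum_sum_type, Matrix.toBlocks₁₁,
        Matrix.toBlocks₁₂, Matrix.toBlocks₂₁, Matrix.toBlocks₂₂] using hsqF _ h i
  · refine mulVec_eq_zero_or _ _ fun z => ?_
    have h := sqE_eq_zero_or_sqF_eq_zero hΦ h0 (v := Sum.elim 0 z) (fun i j => by simp)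
      (Or.inl (by simp [sqE]))
    refine h.imp (fun h => funext fun i => ?_) (fun h => funext fun i => ?_)
    · simpa [Matrix.mulVec, dotProduct, Fintype.sum_sum_type, Matrix.toBlocks₁₁,
        Matrix.toBlocks₁₂, Matrix.toBlocks₂₁, Matrix.toBlocks₂₂] using hsqE _ h i
    · simpa [Matrix.mulVec, dotProduct, Fintype.sum_sum_type, Matrix.toBlocks₁₁,
        Matrix.toBlocks₁₂, Matrix.toBlocks₂₁, Matrix.toBlocks₂₂] using hsqF _ h i

/-! ### The classification -/

/-- The vectors `f_l ⊗ e_k` are orthonormal, so the coefficients are recovered at the vacuum. -/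
theorem coeff_eq_of_sum_genF_mul_genE {c c' : Fin n × Fin m → ℂ}
    (h : ∑ q, c q • (genF u q.2 * genE u q.1) = ∑ q, c' q • (genF u q.2 * genE u q.1)) :
    c = c' := by
  have key : ∀ (c : Fin n × Fin m → ℂ) (r : Fin n × Fin m),
      inner ℂ (fVec u [r.1] [] r.2)
        ((∑ q, c q • (genF u q.2 * genE u q.1) : algA u).1 vac) = c r := by
    intro c r
    have e : ∀ q : Fin n × Fin m, (genF u q.2).1 ((genE u q.1).1 vac) = fVec u [q.1] [] q.2 := by
      intro q
      change Lf u q.2 (Le q.1 (ket ([], []))) = _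
      rw [Le_ket, Lf_ket]
    simp only [AddSubmonoidClass.coe_finsetSum, Subalgebra.coe_smul, Subalgebra.coe_mul, sum_apply,
      smul_apply, mul_apply_eq_comp, e, inner_sum, inner_smul_right, inner_fVec]
    refine (Finset.sum_eq_single r (fun q _ hq => ?_) (by simp)).trans (by simp)
    rw [if_neg, mul_zero]
    intro h
    simp only [List.cons.injEq, and_true] at h
    exact hq (Prod.ext h.1.symm h.2.symm)
  funext r
  rw [← key c r, h, key c' r]

theorem coeff_eq_of_sum_genE_mul_genF {u : Matrix.unitaryGroup (Fin n × Fin n) ℂ}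
    {c c' : Fin n × Fin n → ℂ}
    (h : ∑ q, c q • (genE u q.2 * genF u q.1) = ∑ q, c' q • (genE u q.2 * genF u q.1)) :
    c = c' := by
  have key : ∀ (c : Fin n × Fin n → ℂ) (r : Fin n × Fin n),
      inner ℂ (ket ([r.2], [r.1]))
        ((∑ q, c q • (genE u q.2 * genF u q.1) : algA u).1 vac) = c r := by
    intro c r
    have e : ∀ q : Fin n × Fin n,
        (genE u q.2).1 ((genF u q.1).1 vac) = ket ([q.2], [q.1]) := by
      intro q
      change Le q.2 (Lf u q.1 (ket ([], []))) = _
      rw [Lf_ket, fVec, Le_ket]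
    simp only [AddSubmonoidClass.coe_finsetSum, Subalgebra.coe_smul, Subalgebra.coe_mul, sum_apply,
      smul_apply, mul_apply_eq_comp, e, inner_sum, inner_smul_right, inner_ket]
    refine (Finset.sum_eq_single r (fun q _ hq => ?_) (by simp)).trans (by simp)
    rw [if_neg, mul_zero]
    intro h
    simp only [Prod.mk.injEq, List.cons.injEq, and_true] at h
    exact hq (Prod.ext h.2.symm h.1.symm)
  funext r
  rw [← key c r, h, key c' r]

theorem kronecker_commute_of_apply {Φ : algA u ≃ₐ[ℂ] algA u} {A : Matrix (Fin n) (Fin n) ℂ}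
    {B : Matrix (Fin m) (Fin m) ℂ} (hE : ∀ i, Φ (genE u i) = ∑ t, A i t • genE u t)
    (hF : ∀ j, Φ (genF u j) = ∑ t, B j t • genF u t) : (A ⊗ₖ B) * u.1 = u.1 * (A ⊗ₖ B) := by
  have hrel := relation_iff.1 (relation_gen u)
  ext p q
  refine congrFun (coeff_eq_of_sum_genF_mul_genE (u := u) (c := ((A ⊗ₖ B) * u.1) p)
    (c' := (u.1 * (A ⊗ₖ B)) p) ?_) q
  have h := congrArg Φ (hrel p)
  simp only [map_mul, map_sum, map_smul, hE, hF] at h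
  simp only [sum_smul_mul_sum_smul, sum_smul_mul_sum_smul',
    hrel, sum_smul_sum_smul _ _ fun q : Fin n × Fin m => genF u q.2 * genE u q.1] at h
  exact h

theorem kronecker_tilde_of_apply {u : Matrix.unitaryGroup (Fin n × Fin n) ℂ}
    {Φ : algA u ≃ₐ[ℂ] algA u} {A B : Matrix (Fin n) (Fin n) ℂ}
    (hE : ∀ i, Φ (genE u i) = ∑ t, A i t • genF u t)
    (hF : ∀ j, Φ (genF u j) = ∑ t, B j t • genE u t) :
    (A ⊗ₖ B) * tilde u = u.1 * (A ⊗ₖ B) := by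
  have hrel := relation_iff.1 (relation_gen u)
  ext p q
  refine congrFun (coeff_eq_of_sum_genE_mul_genF (u := u) (c := ((A ⊗ₖ B) * tilde u) p)
    (c' := (u.1 * (A ⊗ₖ B)) p) ?_) q
  have h := congrArg Φ (hrel p)
  simp only [map_mul, map_sum, map_smul, hE, hF] at h
  simp only [sum_smul_mul_sum_smul, sum_smul_mul_sum_smul',
    (relation_gen u).swap_tilde,
    sum_smul_sum_smul _ _ fun q : Fin n × Fin n => genE u q.2 * genF u q.1] at h
  exact h

/-- An isometric automorphism that fixes the vacuum character is linear on the generators, and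
either preserves or exchanges the two families. -/
theorem linear_of_vacChar_eq {Φ : algA u ≃ₐ[ℂ] algA u} (hΦ : Isometry Φ)
    (h0 : ∀ a, vacChar u (Φ a) = vacChar u a) :
    (∃ A ∈ Matrix.unitaryGroup (Fin n) ℂ, ∃ B ∈ Matrix.unitaryGroup (Fin m) ℂ,
      (A ⊗ₖ B) * u.1 = u.1 * (A ⊗ₖ B) ∧ IsPsi u A B Φ) ∨
    (n = m ∧ ∃ (Q : Matrix (Fin n) (Fin m) ℂ) (R : Matrix (Fin m) (Fin n) ℂ),
      Q * Q.conjTranspose = 1 ∧ R * R.conjTranspose = 1 ∧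
      (∀ i, Φ (genE u i) = ∑ t, Q i t • genF u t) ∧
      ∀ j, Φ (genF u j) = ∑ t, R j t • genE u t) := by
  have hM := linMatrix_mem_unitaryGroup hΦ h0
  rw [← Matrix.fromBlocks_toBlocks (linMatrix Φ)] at hM
  have happly := apply_gen_eq_sum hΦ h0
  simp only [Fintype.sum_sum_type] at happly
  obtain ⟨hb1, hb2⟩ := blocks_linMatrix hΦ h0
  rcases blocks_of_unitary hM hb1 hb2 with ⟨hQ, hR, hA, hB⟩ | ⟨hP, hS, hQ, hR, hnm⟩
  · have hE : ∀ i, Φ (genE u i) = ∑ t, (linMatrix Φ).toBlocks₁₁ i t • genE u t := by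
      intro i
      refine (happly (Sum.inl i)).trans ?_
      have h2 : ∀ t, linMatrix Φ (Sum.inl i) (Sum.inr t) = 0 := fun t => congrFun (congrFun hQ i) t
      simp only [h2, zero_smul, Finset.sum_const_zero, add_zero]
      rfl
    have hF : ∀ j, Φ (genF u j) = ∑ t, (linMatrix Φ).toBlocks₂₂ j t • genF u t := by
      intro j
      refine (happly (Sum.inr j)).trans ?_
      have h2 : ∀ t, linMatrix Φ (Sum.inr j) (Sum.inl t) = 0 := fun t => congrFun (congrFun hR j) t
      simp only [h2, zero_smul, Finset.sum_const_zero, zero_add]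
      rfl
    exact Or.inl ⟨_, Matrix.mem_unitaryGroup_iff.2 hA, _, Matrix.mem_unitaryGroup_iff.2 hB,
      kronecker_commute_of_apply hE hF, hΦ, hE, hF⟩
  · refine Or.inr ⟨hnm, _, _, hQ, hR, fun i => ?_, fun j => ?_⟩
    · refine (happly (Sum.inl i)).trans ?_
      have h2 : ∀ t, linMatrix Φ (Sum.inl i) (Sum.inl t) = 0 := fun t => congrFun (congrFun hP i) t
      simp only [h2, zero_smul, Finset.sum_const_zero, zero_add]
      rfl
    · refine (happly (Sum.inr j)).trans ?_
      have h2 : ∀ t, linMatrix Φ (Sum.inr j) (Sum.inr t) = 0 := fun t => congrFun (congrFun hS j) t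
      simp only [h2, zero_smul, Finset.sum_const_zero, add_zero]
      rfl

/-- Pairing `sum_apply` with the vacuum kills the side of the shifts and leaves `x₀ (⟨Ω, T_i Ω⟩ +
z_i) = 0`. -/
theorem inner_vac_mobius {d : ℕ} {L : Fin d → Fock n m →L[ℂ] Fock n m} (hL : RowIsometric L)
    (hvac : ∀ i x, inner ℂ vac (L i x) = (0 : ℂ)) {z : EuclideanSpace ℂ (Fin d)} (hz : ‖z‖ < 1)
    (i : Fin d) : inner ℂ vac (mobius L z i vac) = - z i := by
  obtain ⟨v, -, hv⟩ := exists_isResolvent hL hz ⊤ isClosed_univ fun _ => Algebra.mem_top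
  have h := congrArg (fun x => (inner ℂ vac x : ℂ)) (hv.sum_apply i vac)
  simp only [inner_add_right, inner_smul_right, inner_sum, hvac, Finset.sum_const_zero,
    inner_vac_vac, mul_one, star_eta, ← mul_add] at h
  have hx : (xZero z : ℂ) ≠ 0 := by exact_mod_cast (xZero_pos hz).ne'
  exact eq_neg_of_add_eq_zero_left ((mul_eq_zero.1 h).resolve_left hx)

theorem exists_theta_vacChar_eq {Φ : algA u ≃ₐ[ℂ] algA u} (hΦ : Isometry Φ) :
    ∃ z w Θ, (z, w) ∈ openCore u ∧ IsTheta u z w Θ ∧ ∀ a, vacChar u (Φ a) = vacChar u (Θ a) := by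
  -- The sign offsets the minus sign in `inner_vac_mobius`.
  let z : EuclideanSpace ℂ (Fin n) := WithLp.toLp 2 fun i => - vacChar u (Φ (genE u i))
  let w : EuclideanSpace ℂ (Fin m) := WithLp.toLp 2 fun j => - vacChar u (Φ (genF u j))
  have hz : ‖z‖ < 1 := by
    rw [EuclideanSpace.norm_eq, Real.sqrt_lt' one_pos]
    simpa [z] using sum_norm_vacChar_lt hΦ (g := genE u) rowIsometric_Le
      (fun i => vacChar_gen (Sum.inl i))
  have hw : ‖w‖ < 1 := by
    rw [EuclideanSpace.norm_eq, Real.sqrt_lt' one_pos]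
    simpa [w] using sum_norm_vacChar_lt hΦ (g := genF u) (rowIsometric_Lf u)
      (fun i => vacChar_gen (Sum.inr i))
  have hcore : (z, w) ∈ openCore u := by
    refine ⟨mem_core_of_sums hz.le hw.le (fun i j l => ?_) (fun i j k => ?_), hz, hw⟩
    · simp only [z, mul_neg, Finset.sum_neg_distrib, sum_core_left hΦ]
      split_ifs <;> simp
    · simp only [w, mul_neg, Finset.sum_neg_distrib, sum_core_right hΦ]
      split_ifs <;> simp
  obtain ⟨Θ, hΘ⟩ := exists_isTheta hcore
  refine ⟨z, w, Θ, hcore, hΘ, fun a => ?_⟩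
  have hcont : Continuous (vacChar u) :=
    (continuous_inner_apply vac vac).congr fun a => (vacChar_apply a).symm
  have h := algHom_ext (φ := (vacChar u).comp Φ.toAlgHom) (ψ := (vacChar u).comp Θ.toAlgHom)
    (hcont.comp hΦ.continuous) (hcont.comp hΘ.1.continuous) (fun i => by
      change vacChar u (Φ (genE u i)) = vacChar u (Θ (genE u i))
      rw [vacChar_apply (Θ _), hΘ.2.1 i,
        inner_vac_mobius rowIsometric_Le (fun i x => inner_vac_gen (u := u) (Sum.inl i) x) hz]
      simp [z]) (fun j => by
      change vacChar u (Φ (genF u j)) = vacChar u (Θ (genF u j))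
      rw [vacChar_apply (Θ _), hΘ.2.2 j,
        inner_vac_mobius (rowIsometric_Lf u) (fun i x => inner_vac_gen (u := u) (Sum.inr i) x) hw]
      simp [w])
  exact DFunLike.congr_fun h a

/-- Every isometric automorphism is a product of one that fixes the vacuum character and some
`Θ_{z,w}`. -/
theorem exists_mul_theta {Φ : algA u ≃ₐ[ℂ] algA u} (hΦ : Isometry Φ) :
    ∃ z w, ∃ Ψ Θ : algA u ≃ₐ[ℂ] algA u, (z, w) ∈ openCore u ∧ IsTheta u z w Θ ∧ Isometry Ψ ∧
      (∀ a, vacChar u (Ψ a) = vacChar u a) ∧ Φ = Ψ * Θ := by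
  obtain ⟨z, w, Θ, hc, hΘ, h⟩ := exists_theta_vacChar_eq hΦ
  refine ⟨z, w, Θ.symm.trans Φ, Θ, hc, hΘ, hΦ.comp (isometry_symm hΘ.1), fun a => ?_, ?_⟩
  · rw [AlgEquiv.trans_apply, h, AlgEquiv.apply_symm_apply]
  · refine AlgEquiv.ext fun a => ?_
    change Φ a = Φ (Θ.symm (Θ a))
    rw [AlgEquiv.symm_apply_apply]

end UnitaryRelation

end

/-! ### The main theorem -/

theorem theorem5p11 :
    (∀ (n m : ℕ) (u : Matrix.unitaryGroup (Fin n × Fin m) ℂ),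
      (∀ z w, (z, w) ∈ UnitaryRelation.openCore u → ∃! Θ, UnitaryRelation.IsTheta u z w Θ) ∧
      (∀ A ∈ Matrix.unitaryGroup (Fin n) ℂ, ∀ B ∈ Matrix.unitaryGroup (Fin m) ℂ,
        (A ⊗ₖ B) * u.1 = u.1 * (A ⊗ₖ B) → ∃! Ψ, UnitaryRelation.IsPsi u A B Ψ)) ∧
    (∀ (n m : ℕ), n ≠ m → ∀ (u : Matrix.unitaryGroup (Fin n × Fin m) ℂ)
      (Φ : UnitaryRelation.algA u ≃ₐ[ℂ] UnitaryRelation.algA u),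
      Isometry Φ ↔
        ∃ A ∈ Matrix.unitaryGroup (Fin n) ℂ, ∃ B ∈ Matrix.unitaryGroup (Fin m) ℂ, ∃ z w Ψ Θ,
          (A ⊗ₖ B) * u.1 = u.1 * (A ⊗ₖ B) ∧ (z, w) ∈ UnitaryRelation.openCore u ∧
          UnitaryRelation.IsPsi u A B Ψ ∧ UnitaryRelation.IsTheta u z w Θ ∧ Φ = Ψ * Θ) ∧
    (∀ (n : ℕ) (u : Matrix.unitaryGroup (Fin n × Fin n) ℂ),
      (∀ A ∈ Matrix.unitaryGroup (Fin n) ℂ, ∀ B ∈ Matrix.unitaryGroup (Fin n) ℂ,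
        (A ⊗ₖ B) * UnitaryRelation.tilde u = u.1 * (A ⊗ₖ B) →
          ∃! Ψ, UnitaryRelation.IsPsiTilde u A B Ψ) ∧
      ∀ Φ : UnitaryRelation.algA u ≃ₐ[ℂ] UnitaryRelation.algA u,
        Isometry Φ ↔
          (∃ A ∈ Matrix.unitaryGroup (Fin n) ℂ, ∃ B ∈ Matrix.unitaryGroup (Fin n) ℂ, ∃ z w Ψ Θ,
            (A ⊗ₖ B) * u.1 = u.1 * (A ⊗ₖ B) ∧ (z, w) ∈ UnitaryRelation.openCore u ∧
            UnitaryRelation.IsPsi u A B Ψ ∧ UnitaryRelation.IsTheta u z w Θ ∧ Φ = Ψ * Θ) ∨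
          (∃ A ∈ Matrix.unitaryGroup (Fin n) ℂ, ∃ B ∈ Matrix.unitaryGroup (Fin n) ℂ, ∃ z w Ψ Θ,
            (A ⊗ₖ B) * UnitaryRelation.tilde u = u.1 * (A ⊗ₖ B) ∧
            (z, w) ∈ UnitaryRelation.openCore u ∧
            UnitaryRelation.IsPsiTilde u A B Ψ ∧ UnitaryRelation.IsTheta u z w Θ ∧
            Φ = Ψ * Θ)) := by
  refine ⟨fun n m u => ⟨fun z w h => UnitaryRelation.existsUnique_isTheta h,
    fun A hA B hB h => UnitaryRelation.existsUnique_isPsi hA hB h⟩,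
    fun n m hnm u Φ => ⟨fun hΦ => ?_, ?_⟩,
    fun n u => ⟨fun A hA B hB h => UnitaryRelation.existsUnique_isPsiTilde hA hB h,
      fun Φ => ⟨fun hΦ => ?_, ?_⟩⟩⟩
  · obtain ⟨z, w, Ψ, Θ, hc, hΘ, hΨ, h0, hmul⟩ := UnitaryRelation.exists_mul_theta hΦ
    -- The exchange case carries a proof of `n = m`, which is excluded here.
    rcases UnitaryRelation.linear_of_vacChar_eq hΨ h0 with ⟨A, hA, B, hB, hAB, hPsi⟩ | ⟨h, -⟩
    · exact ⟨A, hA, B, hB, z, w, Ψ, Θ, hAB, hc, hPsi, hΘ, hmul⟩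
    · exact absurd h hnm
  · rintro ⟨A, hA, B, hB, z, w, Ψ, Θ, hAB, hc, hPsi, hΘ, rfl⟩
    exact hPsi.1.comp hΘ.1
  · obtain ⟨z, w, Ψ, Θ, hc, hΘ, hΨ, h0, hmul⟩ := UnitaryRelation.exists_mul_theta hΦ
    rcases UnitaryRelation.linear_of_vacChar_eq hΨ h0 with
      ⟨A, hA, B, hB, hAB, hPsi⟩ | ⟨-, Q, R, hQ, hR, hE, hF⟩
    · exact Or.inl ⟨A, hA, B, hB, z, w, Ψ, Θ, hAB, hc, hPsi, hΘ, hmul⟩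
    · exact Or.inr ⟨Q, Matrix.mem_unitaryGroup_iff.2 hQ, R, Matrix.mem_unitaryGroup_iff.2 hR,
        z, w, Ψ, Θ, UnitaryRelation.kronecker_tilde_of_apply hE hF, hc, ⟨hΨ, hE, hF⟩, hΘ, hmul⟩
  · rintro (⟨A, hA, B, hB, z, w, Ψ, Θ, hAB, hc, hPsi, hΘ, rfl⟩ |
      ⟨A, hA, B, hB, z, w, Ψ, Θ, hAB, hc, hPsi, hΘ, rfl⟩) <;>
    exact hPsi.1.comp hΘ.1
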